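/- Let $\mathcal{C}_0$ be a Barr exact category that has coequalisers of reflexive pairs and enough projectives with respect to regular epimorphisms (every object $B$ admits a regular epimorphism $P\to B$ whose domain $P$ has the lifting property against all regular epimorphisms). For a category $\mathcal{Y}$ with a class $\mathcal{E}$ of morphisms, called extensions, an $\mathcal{E}$-double extension is a commutative square $(\alpha_\top,\alpha_\bot)\colon f_A\to f_B$ whose four sides, the two projections of the pullback $A_\bot\times_{B_\bot}B_\top$, and the comparison map $A_\top\to A_\bot\times_{B_\bot}B_\top$ all lie in $\mathcal{E}$. Let $\mathcal{E}_1$ be the class of regular epimorphisms of $\mathcal{C}_0$; inductively let $\mathcal{E}_{k+1}$ be the class of those morphisms of the category $\mathsf{Arr}^k(\mathcal{C}_0)$ of $k$-fold arrows that are $\mathcal{E}_k$-double extensions. For $k\ge 1$ let $\mathcal{C}_k=\mathsf{Ext}(\mathcal{C}_{k-1})$ be the full subcategory of $\mathsf{Arr}^k(\mathcal{C}_0)$ on the elements of $\mathcal{E}_k$. Given a full replete reflective subcategory of $\mathcal{Y}$, with reflector $L$ and unit $\eta$ having components in $\mathcal{E}$, the reflection is strongly $\mathcal{E}$-Birkhoff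 if for each extension $f\colon A\to B$ the reflection square $(\eta_A,\eta_B)\colon f\to L(f)$ is an $\mathcal{E}$-double extension. An extension is a trivial covering if its reflection square is a pullback, and a covering if its pullback along some extension is a trivial covering; $\mathsf{Cov}(\mathcal{Y})$ is the full subcategory of $\mathsf{Ext}(\mathcal{Y})$ on the coverings. Let $n\ge 0$ and suppose that for each $0\le k\le n$ a full replete subcategory $\mathcal{B}_k$ of $\mathcal{C}_k$ is given, which is reflective with reflector $F_k$ and unit $\eta^k$ having components in $\mathcal{E}_{k+1}$, is strongly $\mathcal{E}_{k+1}$-Birkhoff, and, when $k\ge 1$, satisfies $\mathcal{B}_k=\mathsf{Cov}(\mathcal{C}_{k-1})$. Then the category $\mathcal{B}_{n+1}=\mathsf{Cov}(\mathcal{C}_n)$ of coverings with respect to $F_n$ is reflective in $\mathcal{C}_{n+1}=\mathsf{Ext}(\mathcal{C}_n)$. Moreover, let $f\colon A\to B$ be an extension in $\mathcal{C}_n$. There is an extension $p\colon P\to B$ in $\mathcal{C}_n$ with $P$ projective with respect to $\mathcal{E}_{n+1}$; and for every such $p$, with pullback projections $\pi_P\colon P\times_BA\to P$ and $\pi_A\colon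 P\times_BA\to A$, and with $\hat f\colon \mathrm{Eq}(\pi_A)\to \mathrm{Eq}(p)$ the induced morphism between the kernel pairs, let $\mathrm{Triv}(\pi_P)$ and $\mathrm{Triv}(\hat f)$ be the pullbacks of $F_n(\pi_P)$ and $F_n(\hat f)$ along the units $\eta^n_P$ and $\eta^n_{\mathrm{Eq}(p)}$, let $\tau\colon P\times_BA\to\operatorname{dom}\mathrm{Triv}(\pi_P)$ be the comparison map, and let $\pi_1,\pi_2\colon \operatorname{dom}\mathrm{Triv}(\hat f)\rightrightarrows\operatorname{dom}\mathrm{Triv}(\pi_P)$ be induced by the kernel pair projections (all taken in $\mathcal{C}_n$; for at least one $p$ all these objects exist, and for any given $p$ the following holds for every choice of them). Then $\pi_1,\pi_2$ have a coequaliser $r$ in $\mathcal{C}_n$, with codomain $C_f$ say, and there are morphisms $h\colon A\to C_f$ and $g\colon C_f\to B$ with $r\tau=h\pi_A$, $gr=p\,\mathrm{Triv}(\pi_P)$ and $gh=f$, such that $g$ is a covering and $(h,1_B)\colon f\to g$ is universal among the morphisms in $\mathcal{C}_{n+1}$ from $f$ to coverings. -/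

import Mathlib

open CategoryTheory CategoryTheory.Limits

universe v u w w'

namespace HigherCoverings

section Generic

variable {Y : Type w} [Category.{w'} Y]

/-- The commutative square with top side `αt : A₁ ⟶ B₁`, left side `fA : A₁ ⟶ A₀`, right side
`fB : B₁ ⟶ B₀` and bottom side `αb : A₀ ⟶ B₀` is an `E`-double extension: its four sides, the two
projections of the pullback of `αb` and `fB`, and the comparison map `A₁ ⟶ A₀ ×_{B₀} B₁` all
belong to the class `E`. -/
structure IsDoubleExtension (E : MorphismProperty Y) {A₁ B₁ A₀ B₀ : Y}
    (αt : A₁ ⟶ B₁) (fA : A₁ ⟶ A₀) (fB : B₁ ⟶ B₀) (αb : A₀ ⟶ B₀) : Prop where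
  comm : αt ≫ fB = fA ≫ αb
  top_mem : E αt
  left_mem : E fA
  right_mem : E fB
  bot_mem : E αb
  comparison : ∃ (P : Y) (π₁ : P ⟶ A₀) (π₂ : P ⟶ B₁) (p : A₁ ⟶ P),
    IsPullback π₁ π₂ αb fB ∧ p ≫ π₁ = fA ∧ p ≫ π₂ = αt ∧ E π₁ ∧ E π₂ ∧ E p

/-- The `E`-double extensions, as a class of morphisms of the arrow category. -/
def doubleExtensions (E : MorphismProperty Y) : MorphismProperty (Arrow Y) :=
  fun f g α => IsDoubleExtension E α.left f.hom g.hom α.right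

/-- `P` is projective with respect to the morphisms of the class `E`. -/
def IsProjectiveFor (E : MorphismProperty Y) (P : Y) : Prop :=
  ∀ ⦃A B : Y⦄ (e : A ⟶ B), E e → ∀ b : P ⟶ B, ∃ a : P ⟶ A, a ≫ e = b

/-- A full replete `E`-reflective subcategory of `Y`, with a chosen reflector `L`: the components
of the unit of the adjunction belong to `E`. -/
structure GaloisStructure (E : MorphismProperty Y) where
  /-- the objects of the subcategory -/
  X : ObjectProperty Y
  replete : X.IsClosedUnderIsomorphisms
  /-- the reflector -/
  L : Y ⥤ X.FullSubcategory
  /-- the reflector is left adjoint to the inclusion -/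
  adj : L ⊣ X.ι
  unit_mem : ∀ A : Y, E (adj.unit.app A)

namespace GaloisStructure

variable {E : MorphismProperty Y} (Γ : GaloisStructure E)

/-- The reflection of an object, seen in `Y`. -/
abbrev refl (A : Y) : Y := (Γ.L.obj A).obj

/-- The reflection of a morphism, seen in `Y`. -/
abbrev reflMap {A B : Y} (f : A ⟶ B) : Γ.refl A ⟶ Γ.refl B := Γ.X.ι.map (Γ.L.map f)

/-- The unit of the reflection. -/
abbrev η (A : Y) : A ⟶ Γ.refl A := Γ.adj.unit.app A

/-- The reflection square at every extension is a double extension. -/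
def StronglyBirkhoff : Prop :=
  ∀ ⦃A B : Y⦄ (f : A ⟶ B), E f → IsDoubleExtension E (Γ.η A) f (Γ.reflMap f) (Γ.η B)

/-- Trivial coverings: extensions whose reflection square is a pullback. -/
def trivialCovering : MorphismProperty Y :=
  fun A B t => E t ∧ IsPullback (Γ.η A) t (Γ.reflMap t) (Γ.η B)

/-- Coverings: extensions `c` such that the pullback of `c` along some extension `e` is a trivial
covering. -/
def covering : MorphismProperty Y :=
  fun A B c => E c ∧ ∃ (S T : Y) (e : S ⟶ B) (t : T ⟶ S) (a : T ⟶ A),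
    E e ∧ IsPullback a t c e ∧ Γ.trivialCovering t

/-- The trivialisation of `f : A ⟶ B`: the pullback of the reflection of `f` along the unit at
`B`, with the comparison map from `A`. -/
structure Trivialisation {A B : Y} (f : A ⟶ B) where
  /-- the domain of the trivialisation -/
  obj : Y
  /-- the trivialisation -/
  map : obj ⟶ B
  /-- the other projection of the pullback -/
  toRefl : obj ⟶ Γ.refl A
  isPullback : IsPullback toRefl map (Γ.reflMap f) (Γ.η B)
  /-- the comparison map -/
  τ : A ⟶ obj
  τ_map : τ ≫ map = f
  τ_toRefl : τ ≫ toRefl = Γ.η A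

/-- For `f : A ⟶ B`: a projective presentation `p : P ⟶ B`, the pullback `πP : X ⟶ P` of `f` along
`p`, the kernel pairs of `πA : X ⟶ A` and of `p`, the induced `fhat` between them, the
trivialisations of `fhat` and of `πP`, and the two morphisms `π₁`, `π₂` between the domains of
these that are induced by the projections of the kernel pairs. -/
structure TrivialisedPresentation {A B : Y} (f : A ⟶ B) where
  /-- the projective object -/
  P : Y
  /-- the presentation -/
  p : P ⟶ B
  p_mem : E p
  projective : IsProjectiveFor E P
  /-- the pullback of `f` and `p` -/
  X : Y
  /-- the projection to `A` -/
  πA : X ⟶ A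
  /-- the projection to `P` -/
  πP : X ⟶ P
  isPullback : IsPullback πA πP f p
  /-- the kernel pair of `πA` -/
  R : Y
  /-- its first projection -/
  d₁ : R ⟶ X
  /-- its second projection -/
  d₂ : R ⟶ X
  isKernelPair_πA : IsKernelPair πA d₁ d₂
  /-- the kernel pair of `p` -/
  Q : Y
  /-- its first projection -/
  q₁ : Q ⟶ P
  /-- its second projection -/
  q₂ : Q ⟶ P
  isKernelPair_p : IsKernelPair p q₁ q₂
  /-- the induced morphism between the kernel pairs -/
  fhat : R ⟶ Q
  fhat_q₁ : fhat ≫ q₁ = d₁ ≫ πP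
  fhat_q₂ : fhat ≫ q₂ = d₂ ≫ πP
  /-- the trivialisation of `πP` -/
  trivX : Γ.Trivialisation πP
  /-- the trivialisation of `fhat` -/
  trivR : Γ.Trivialisation fhat
  /-- the morphism induced by the first projections -/
  π₁ : trivR.obj ⟶ trivX.obj
  /-- the morphism induced by the second projections -/
  π₂ : trivR.obj ⟶ trivX.obj
  π₁_map : π₁ ≫ trivX.map = trivR.map ≫ q₁
  π₁_toRefl : π₁ ≫ trivX.toRefl = trivR.toRefl ≫ Γ.reflMap d₁
  π₂_map : π₂ ≫ trivX.map = trivR.map ≫ q₂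
  π₂_toRefl : π₂ ≫ trivX.toRefl = trivR.toRefl ≫ Γ.reflMap d₂

/-- `(h, 𝟙 B)` is a morphism from the extension `f : A ⟶ B` to the covering `g : A' ⟶ B`, and it
is universal among the morphisms from `f` to coverings. -/
structure IsCoveringReflection {A A' B : Y} (f : A ⟶ B) (h : A ⟶ A') (g : A' ⟶ B) : Prop where
  fac : h ≫ g = f
  covering : Γ.covering g
  universal : ∀ ⦃D D' : Y⦄ (c : D ⟶ D'), Γ.covering c → ∀ (a : A ⟶ D) (b : B ⟶ D'),
    a ≫ c = f ≫ b → ∃! x : A' ⟶ D, h ≫ x = a ∧ x ≫ c = g ≫ b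

end GaloisStructure

end Generic

/-- Barr exact categories: regular categories in which every internal equivalence relation is a
kernel pair. -/
class BarrExact (C : Type w) [Category.{w'} C] : Prop extends Regular C where
  effective : ∀ ⦃R A : C⦄ (p₁ p₂ : R ⟶ A), IsEquivalenceRelation p₁ p₂ →
    ∃ (B : C) (q : A ⟶ B), IsKernelPair q p₁ p₂

/-- Enough projectives, with respect to regular epimorphisms. -/
class EnoughRegularProjectives (C : Type w) [Category.{w'} C] : Prop where
  presentation : ∀ B : C, ∃ (P : C) (p : P ⟶ B),
    IsRegularEpi p ∧ IsProjectiveFor (MorphismProperty.regularEpi C) P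

section Tower

variable (C : Type (max u v)) [Category.{v} C]

/-- The category `Arrⁿ(C)` of `n`-fold arrows of `C`. -/
def arr : ℕ → Cat.{v, max u v}
  | 0 => Cat.of C
  | n + 1 => Cat.of (Arrow (arr n))

/-- The class of `(n+1)`-fold extensions, as a class of morphisms of `Arrⁿ(C)`: regular
epimorphisms for `n = 0`, and double extensions of `n`-fold extensions for `n > 0`. -/
def ext : (n : ℕ) → MorphismProperty (arr.{v, u} C n)
  | 0 => MorphismProperty.regularEpi C
  | n + 1 => doubleExtensions (ext n)

/-- The `n`-fold extensions, as objects of `Arrⁿ(C)`. Every object of `C` is a `0`-fold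
extension. -/
def isExt : (n : ℕ) → ObjectProperty (arr.{v, u} C n)
  | 0 => fun _ => True
  | n + 1 => fun f : Arrow (arr.{v, u} C n) => ext C n f.hom

/-- The category `Cₙ = Extⁿ(C)` of `n`-fold extensions. -/
abbrev Level (n : ℕ) : Type (max u v) := (isExt.{v, u} C n).FullSubcategory

/-- The class of extensions in `Cₙ`: the `(n+1)`-fold extensions. -/
def levelExt (n : ℕ) : MorphismProperty (Level.{v, u} C n) :=
  (ext.{v, u} C n).inverseImage (isExt.{v, u} C n).ι

variable {C}

theorem isExt_source : ∀ {n : ℕ} {A B : arr.{v, u} C n} (f : A ⟶ B),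
    ext.{v, u} C n f → isExt.{v, u} C n A
  | 0, _, _, _, _ => trivial
  | _ + 1, _, _, _, h => h.left_mem

theorem isExt_target : ∀ {n : ℕ} {A B : arr.{v, u} C n} (f : A ⟶ B),
    ext.{v, u} C n f → isExt.{v, u} C n B
  | 0, _, _, _, _ => trivial
  | _ + 1, _, _, _, h => h.right_mem

namespace Level

variable {n : ℕ}

/-- The morphism of `n`-fold arrows underlying an object of `Cₙ₊₁`. -/
abbrev toArrow (F : Level.{v, u} C (n + 1)) : Arrow (arr.{v, u} C n) := F.obj

/-- The domain of an `(n+1)`-fold extension, as an object of `Cₙ`. -/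
def dom (F : Level.{v, u} C (n + 1)) : Level.{v, u} C n :=
  ⟨F.toArrow.left, isExt_source F.toArrow.hom F.property⟩

/-- The codomain of an `(n+1)`-fold extension, as an object of `Cₙ`. -/
def cod (F : Level.{v, u} C (n + 1)) : Level.{v, u} C n :=
  ⟨F.toArrow.right, isExt_target F.toArrow.hom F.property⟩

/-- An object of `Cₙ₊₁`, seen as a morphism of `Cₙ`. -/
def toHom (F : Level.{v, u} C (n + 1)) : F.dom ⟶ F.cod :=
  ObjectProperty.homMk F.toArrow.hom

end Level

/-- The coverings of a Galois structure on `Cₙ`, as objects of `Cₙ₊₁ = Ext(Cₙ)`. The associated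
full subcategory is `Cov(Cₙ)`. -/
def Cov {n : ℕ} (Γ : GaloisStructure (levelExt.{v, u} C n)) :
    ObjectProperty (Level.{v, u} C (n + 1)) :=
  fun F => Γ.covering F.toHom

variable (C)

/-- A tower of strongly Birkhoff Galois structures `Γ₀, …, Γₙ` over `C`: the ambient category of
`Γₖ` is `Cₖ` with the `(k+1)`-fold extensions, and the reflective subcategory of `Γₖ₊₁` is that of
the `Γₖ`-coverings. -/
structure GaloisTower (n : ℕ) where
  /-- the Galois structure at level `k` -/
  Γ : ∀ k : ℕ, k ≤ n → GaloisStructure (levelExt.{v, u} C k)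
  stronglyBirkhoff : ∀ (k : ℕ) (hk : k ≤ n), (Γ k hk).StronglyBirkhoff
  eq_cov : ∀ (k : ℕ) (hk : k + 1 ≤ n),
    (Γ (k + 1) hk).X = Cov (Γ k (Nat.le_of_succ_le hk))

variable {C}

/-- The Galois structure at the highest level of the tower. -/
abbrev GaloisTower.last {n : ℕ} (T : GaloisTower.{v, u} C n) :
    GaloisStructure (levelExt.{v, u} C n) :=
  T.Γ n le_rfl

end Tower

end HigherCoverings

namespace HigherCoverings

/-! ### Componentwise pullbacks and pushouts in arrow categories -/

section ArrowLimits

variable {Y : Type w} [Category.{w'} Y]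

/-! The reflection of `f` into coverings is the pushout of `πA` along the comparison map `τ` of the
trivialisation of `πP`. Since `P` is projective, `p` followed by any map into the base of a covering
lifts through an extension that splits this covering. The covering therefore becomes trivial over
`P`, and every morphism from `f` to it factors, on domains and after `πA`, through the
trivialisation; this is the universal property of the pushout. The induced `g` is a covering because
its pullback along `p` is a quotient, by an extension, of a trivial covering, and such quotients are
trivial (`trivialCovering_of_quotient`). As `πA` is the coequaliser of its kernel pair and the
comparison map of `trivR` is epic, the same pushout is the coequaliser of `π₁` and `π₂`.

What remains is to show that the pushout exists and that `h` and `g` are extensions; for higher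
extensions this is not formal. The key is that each unit of the tower is invertible at every vertex
of the cube except the initial one (`GaloisTower.corner_η`). Then so is `τ`, and the pushout alters
only the initial vertex, where it is a pushout of regular epimorphisms in `C`, built from a
reflexive coequaliser. The resulting `h` is again invertible away from the initial vertex, and the
unit one level up is `(h, 𝟙)` up to isomorphism, so the induction continues.

The argument at one level uses only the axioms `IsExtensionClass` and `IsCornerClass`. Both hold for
regular epimorphisms in `C`, and pass to arrow categories and then to full subcategories of
extensions. -/

theorem isPullback_lift_comm {P₁ A₁ B₁ D₁ P₀ A₀ B₀ D₀ T₁ T₀ : Y} {fst₁ : P₁ ⟶ A₁}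
    {snd₁ : P₁ ⟶ D₁} {f₁ : A₁ ⟶ B₁} {g₁ : D₁ ⟶ B₁} {fst₀ : P₀ ⟶ A₀} {snd₀ : P₀ ⟶ D₀}
    {f₀ : A₀ ⟶ B₀} {g₀ : D₀ ⟶ B₀} (h₁ : IsPullback fst₁ snd₁ f₁ g₁)
    (h₀ : IsPullback fst₀ snd₀ f₀ g₀) {P : P₁ ⟶ P₀} {A : A₁ ⟶ A₀} {D : D₁ ⟶ D₀} {T : T₁ ⟶ T₀}
    (hA : fst₁ ≫ A = P ≫ fst₀) (hD : snd₁ ≫ D = P ≫ snd₀) {a₁ : T₁ ⟶ A₁} {b₁ : T₁ ⟶ D₁}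
    {a₀ : T₀ ⟶ A₀} {b₀ : T₀ ⟶ D₀} (ha : a₁ ≫ A = T ≫ a₀) (hb : b₁ ≫ D = T ≫ b₀)
    (e₁ : a₁ ≫ f₁ = b₁ ≫ g₁) (e₀ : a₀ ≫ f₀ = b₀ ≫ g₀) :
    h₁.lift a₁ b₁ e₁ ≫ P = T ≫ h₀.lift a₀ b₀ e₀ := by
  apply h₀.hom_ext
  · rw [Category.assoc, ← hA, IsPullback.lift_fst_assoc, ha, Category.assoc, IsPullback.lift_fst]
  · rw [Category.assoc, ← hD, IsPullback.lift_snd_assoc, hb, Category.assoc, IsPullback.lift_snd]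

theorem arrow_isPullback_of_components {P A B D : Arrow Y} {fst : P ⟶ A} {snd : P ⟶ D}
    {f : A ⟶ B} {g : D ⟶ B} (hl : IsPullback fst.left snd.left f.left g.left)
    (hr : IsPullback fst.right snd.right f.right g.right) : IsPullback fst snd f g := by
  refine IsPullback.mk' (Arrow.hom_ext _ _ hl.w hr.w) ?_ ?_
  · intro T φ φ' h₁ h₂
    exact Arrow.hom_ext _ _
      (hl.hom_ext (congrArg CommaMorphism.left h₁) (congrArg CommaMorphism.left h₂))
      (hr.hom_ext (congrArg CommaMorphism.right h₁) (congrArg CommaMorphism.right h₂))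
  · intro T a b hab
    exact ⟨Arrow.homMk (hl.lift a.left b.left (congrArg CommaMorphism.left hab))
      (hr.lift a.right b.right (congrArg CommaMorphism.right hab))
      (isPullback_lift_comm hl hr (Arrow.w fst) (Arrow.w snd) (Arrow.w a) (Arrow.w b) _ _),
      Arrow.hom_ext _ _ (hl.lift_fst _ _ _) (hr.lift_fst _ _ _),
      Arrow.hom_ext _ _ (hl.lift_snd _ _ _) (hr.lift_snd _ _ _)⟩

theorem arrow_isPullback_components [HasPullbacks Y] {P A B D : Arrow Y} {fst : P ⟶ A}
    {snd : P ⟶ D} {f : A ⟶ B} {g : D ⟶ B} (h : IsPullback fst snd f g) :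
    IsPullback fst.left snd.left f.left g.left ∧
      IsPullback fst.right snd.right f.right g.right := by
  have hl := IsPullback.of_hasPullback f.left g.left
  have hr := IsPullback.of_hasPullback f.right g.right
  have e : (pullback.fst f.left g.left ≫ A.hom) ≫ f.right =
      (pullback.snd f.left g.left ≫ D.hom) ≫ g.right := by
    rw [Category.assoc, Category.assoc, ← Arrow.w f, ← Arrow.w g, hl.w_assoc]
  let Q : Arrow Y := Arrow.mk (hr.lift _ _ e)
  let q₁ : Q ⟶ A := Arrow.homMk (pullback.fst f.left g.left) (pullback.fst f.right g.right)
    (hr.lift_fst _ _ e).symm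
  let q₂ : Q ⟶ D := Arrow.homMk (pullback.snd f.left g.left) (pullback.snd f.right g.right)
    (hr.lift_snd _ _ e).symm
  have hQ : IsPullback q₁ q₂ f g := arrow_isPullback_of_components hl hr
  have e₁ := h.isoIsPullback_inv_fst _ _ hQ
  have e₂ := h.isoIsPullback_inv_snd _ _ hQ
  constructor
  · exact hl.of_iso (Arrow.leftFunc.mapIso (h.isoIsPullback _ _ hQ).symm) (Iso.refl _)
      (Iso.refl _) (Iso.refl _)
      ((Category.comp_id _).trans (congrArg CommaMorphism.left e₁).symm)
      ((Category.comp_id _).trans (congrArg CommaMorphism.left e₂).symm)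
      (by simp) (by simp)
  · exact hr.of_iso (Arrow.rightFunc.mapIso (h.isoIsPullback _ _ hQ).symm) (Iso.refl _)
      (Iso.refl _) (Iso.refl _)
      ((Category.comp_id _).trans (congrArg CommaMorphism.right e₁).symm)
      ((Category.comp_id _).trans (congrArg CommaMorphism.right e₂).symm)
      (by simp) (by simp)

theorem isPushout_desc_comm {X₁ T₁ A₁ D₁ T₀ A₀ D₀ X₀ Z₁ Z₀ : Y} {τ₁ : X₁ ⟶ T₁} {π₁ : X₁ ⟶ A₁}
    {r₁ : T₁ ⟶ D₁} {h₁ : A₁ ⟶ D₁} {τ₀ : X₀ ⟶ T₀} {π₀ : X₀ ⟶ A₀} {r₀ : T₀ ⟶ D₀} {h₀ : A₀ ⟶ D₀}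
    (p₁ : IsPushout τ₁ π₁ r₁ h₁) (p₀ : IsPushout τ₀ π₀ r₀ h₀) {T : T₁ ⟶ T₀} {A : A₁ ⟶ A₀}
    {D : D₁ ⟶ D₀} {Z : Z₁ ⟶ Z₀} (hr : r₁ ≫ D = T ≫ r₀) (hh : h₁ ≫ D = A ≫ h₀) {a₁ : T₁ ⟶ Z₁}
    {b₁ : A₁ ⟶ Z₁} {a₀ : T₀ ⟶ Z₀} {b₀ : A₀ ⟶ Z₀} (ha : a₁ ≫ Z = T ≫ a₀) (hb : b₁ ≫ Z = A ≫ b₀)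
    (e₁ : τ₁ ≫ a₁ = π₁ ≫ b₁) (e₀ : τ₀ ≫ a₀ = π₀ ≫ b₀) :
    p₁.desc a₁ b₁ e₁ ≫ Z = D ≫ p₀.desc a₀ b₀ e₀ := by
  apply p₁.hom_ext
  · rw [IsPushout.inl_desc_assoc, ha, reassoc_of% hr, IsPushout.inl_desc]
  · rw [IsPushout.inr_desc_assoc, hb, reassoc_of% hh, IsPushout.inr_desc]

theorem arrow_isPushout_of_components {X T A D : Arrow Y} {τ : X ⟶ T} {π : X ⟶ A} {r : T ⟶ D}
    {h : A ⟶ D} (hl : IsPushout τ.left π.left r.left h.left)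
    (hr : IsPushout τ.right π.right r.right h.right) : IsPushout τ π r h := by
  refine IsPushout.mk' (Arrow.hom_ext _ _ hl.w hr.w) ?_ ?_
  · intro T φ φ' h₁ h₂
    exact Arrow.hom_ext _ _
      (hl.hom_ext (congrArg CommaMorphism.left h₁) (congrArg CommaMorphism.left h₂))
      (hr.hom_ext (congrArg CommaMorphism.right h₁) (congrArg CommaMorphism.right h₂))
  · intro Z a b hab
    exact ⟨Arrow.homMk (hl.desc a.left b.left (congrArg CommaMorphism.left hab))
      (hr.desc a.right b.right (congrArg CommaMorphism.right hab))
      (isPushout_desc_comm hl hr (Arrow.w r) (Arrow.w h) (Arrow.w a) (Arrow.w b) _ _),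
      Arrow.hom_ext _ _ (hl.inl_desc _ _ _) (hr.inl_desc _ _ _),
      Arrow.hom_ext _ _ (hl.inr_desc _ _ _) (hr.inr_desc _ _ _)⟩

end ArrowLimits

/-! ### Axioms for extensions, and their passage to double extensions -/

section ExtensionClasses

variable {Y : Type w} [Category.{w'} Y]

/-- The exactness properties of a class `E` of extensions between the objects satisfying `O`. -/
structure IsExtensionClass (E : MorphismProperty Y) (O : ObjectProperty Y) : Prop where
  source : ∀ ⦃A B : Y⦄ {f : A ⟶ B}, E f → O A
  target : ∀ ⦃A B : Y⦄ {f : A ⟶ B}, E f → O B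
  of_isIso : ∀ ⦃A B : Y⦄ (f : A ⟶ B) [IsIso f], O A → E f
  comp : ∀ ⦃A B D : Y⦄ {f : A ⟶ B} {g : B ⟶ D}, E f → E g → E (f ≫ g)
  cancel : ∀ ⦃A B D : Y⦄ {f : A ⟶ B} {g : B ⟶ D}, E f → E (f ≫ g) → E g
  pullback_fst : ∀ ⦃P A B D : Y⦄ {fst : P ⟶ A} {snd : P ⟶ D} {f : A ⟶ B} {g : D ⟶ B},
    IsPullback fst snd f g → E g → O A → E fst
  epi : ∀ ⦃A B : Y⦄ {f : A ⟶ B}, E f → Epi f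
  desc : ∀ ⦃A B R Z : Y⦄ {f : A ⟶ B} {a b : R ⟶ A}, E f → IsKernelPair f a b →
    ∀ k : A ⟶ Z, a ≫ k = b ≫ k → ∃ l : B ⟶ Z, f ≫ l = k
  enough_projectives : ∀ B : Y, O B → ∃ (P : Y) (p : P ⟶ B), E p ∧ IsProjectiveFor E P

/-- The properties of a class `V` of morphisms that are invertible away from the initial vertex of
a cube, and of the class `W` of those among them that are regular epimorphisms at that vertex. -/
structure IsCornerClass (E : MorphismProperty Y) (O : ObjectProperty Y)
    (V W : MorphismProperty Y) : Prop where
  of_isIso : ∀ ⦃A B : Y⦄ (f : A ⟶ B) [IsIso f], V f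
  comp : ∀ ⦃A B D : Y⦄ {f : A ⟶ B} {g : B ⟶ D}, V f → V g → V (f ≫ g)
  cancel : ∀ ⦃A B D : Y⦄ {f : A ⟶ B} {g : B ⟶ D}, V (f ≫ g) → V g → V f
  pullback_fst : ∀ ⦃P A B D : Y⦄ {fst : P ⟶ A} {snd : P ⟶ D} {f : A ⟶ B} {g : D ⟶ B},
    IsPullback fst snd f g → E g → V g → V fst
  quotient_of_mem : ∀ ⦃A B : Y⦄ {f : A ⟶ B}, V f → E f → W f
  of_quotient : ∀ ⦃A B : Y⦄ {f : A ⟶ B}, W f → V f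
  -- The condition `O A` is needed since in an arrow category a member of `W` may have ends that are
  -- not extensions.
  mem_of_quotient : ∀ ⦃A B : Y⦄ {f : A ⟶ B}, W f → O A → E f
  quotient_cancel : ∀ ⦃A B D : Y⦄ {f : A ⟶ B} {g : B ⟶ D}, W f → E (f ≫ g) → E g
  exists_pushout : ∀ ⦃X T A : Y⦄ {τ : X ⟶ T} {π : X ⟶ A}, W τ → E π →
    ∃ (D : Y) (r : T ⟶ D) (h : A ⟶ D), IsPushout τ π r h ∧ W h

/-- An arrow between projectives is projective for double extensions: lift at the codomain, then
lift the induced map to the pullback through the comparison map. -/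
theorem exists_lift_of_isDoubleExtension {E : MorphismProperty Y} {A₁ B₁ A₀ B₀ Q₁ Q₀ : Y}
    {αt : A₁ ⟶ B₁} {fA : A₁ ⟶ A₀} {fB : B₁ ⟶ B₀} {αb : A₀ ⟶ B₀} {q : Q₁ ⟶ Q₀} {γt : Q₁ ⟶ B₁}
    {γb : Q₀ ⟶ B₀}
    (h₁ : IsProjectiveFor E Q₁) (h₀ : IsProjectiveFor E Q₀)
    (hα : IsDoubleExtension E αt fA fB αb) (wγ : γt ≫ fB = q ≫ γb) :
    ∃ (δt : Q₁ ⟶ A₁) (δb : Q₀ ⟶ A₀), δt ≫ fA = q ≫ δb ∧ δt ≫ αt = γt ∧ δb ≫ αb = γb := by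
  obtain ⟨δb, hδb⟩ := h₀ αb hα.bot_mem γb
  obtain ⟨M, π₁, π₂, p, hM, hp₁, hp₂, -, -, hp⟩ := hα.comparison
  obtain ⟨δt, hδt⟩ := h₁ p hp (hM.lift (q ≫ δb) γt (by rw [Category.assoc, hδb, wγ]))
  refine ⟨δt, δb, ?_, ?_, hδb⟩
  · rw [← hp₁, reassoc_of% hδt, hM.lift_fst]
  · rw [← hp₂, reassoc_of% hδt, hM.lift_snd]

namespace IsExtensionClass

variable {E : MorphismProperty Y} {O : ObjectProperty Y} (hE : IsExtensionClass E O)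

include hE

theorem pullback_snd {P A B D : Y} {fst : P ⟶ A} {snd : P ⟶ D} {f : A ⟶ B} {g : D ⟶ B}
    (h : IsPullback fst snd f g) (hf : E f) (hD : O D) : E snd :=
  hE.pullback_fst h.flip hf hD

theorem comp_isIso {A B D : Y} {f : A ⟶ B} (g : B ⟶ D) [IsIso g] (hf : E f) : E (f ≫ g) :=
  hE.comp hf (hE.of_isIso g (hE.target hf))

theorem isIso_comp {A B D : Y} (f : A ⟶ B) [IsIso f] {g : B ⟶ D} (hg : E g) : E (f ≫ g) :=
  hE.comp (hE.of_isIso f (hE.target (hE.of_isIso (inv f) (hE.source hg)))) hg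

/-- An extension that is a split monomorphism is invertible. -/
theorem isIso_of_retraction {A B : Y} {f : A ⟶ B} (hf : E f) (r : B ⟶ A) (hr : f ≫ r = 𝟙 A) :
    IsIso f := by
  have := hE.epi hf
  exact ⟨r, hr, by rw [← cancel_epi f, reassoc_of% hr, Category.comp_id]⟩

theorem isDoubleExtension {A₁ B₁ A₀ B₀ P : Y} {αt : A₁ ⟶ B₁} {fA : A₁ ⟶ A₀} {fB : B₁ ⟶ B₀}
    {αb : A₀ ⟶ B₀} {π₁ : P ⟶ A₀} {π₂ : P ⟶ B₁} {p : A₁ ⟶ P} (hb : E αb) (hB : E fB)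
    (hP : IsPullback π₁ π₂ αb fB) (h₁ : p ≫ π₁ = fA) (h₂ : p ≫ π₂ = αt) (hp : E p) :
    IsDoubleExtension E αt fA fB αb := by
  have hπ₁ : E π₁ := hE.pullback_fst hP hB (hE.source hb)
  have hπ₂ : E π₂ := hE.pullback_snd hP hb (hE.source hB)
  refine ⟨by rw [← h₁, ← h₂, Category.assoc, Category.assoc, hP.w], ?_, ?_, hB, hb,
    P, π₁, π₂, p, hP, h₁, h₂, hπ₁, hπ₂, hp⟩
  · exact h₂ ▸ hE.comp hp hπ₂
  · exact h₁ ▸ hE.comp hp hπ₁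

/-- The definition of a double extension only provides some pullback; the comparison maps to two
pullbacks differ by an isomorphism. -/
theorem comparison_mem {A₁ B₁ A₀ B₀ P : Y} {αt : A₁ ⟶ B₁} {fA : A₁ ⟶ A₀} {fB : B₁ ⟶ B₀}
    {αb : A₀ ⟶ B₀} {π₁ : P ⟶ A₀} {π₂ : P ⟶ B₁} {p : A₁ ⟶ P}
    (h : IsDoubleExtension E αt fA fB αb) (hP : IsPullback π₁ π₂ αb fB)
    (h₁ : p ≫ π₁ = fA) (h₂ : p ≫ π₂ = αt) : E p := by
  obtain ⟨P', π₁', π₂', p', hP', h₁', h₂', -, -, hp'⟩ := h.comparison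
  have : p = p' ≫ (hP'.isoIsPullback _ _ hP).hom := by
    apply hP.hom_ext <;> simp [*]
  rw [this]
  exact hE.comp_isIso _ hp'

theorem isDoubleExtension_of_isIso {A₁ B₁ A₀ B₀ : Y} {αt : A₁ ⟶ B₁} {fA : A₁ ⟶ A₀}
    {fB : B₁ ⟶ B₀} {αb : A₀ ⟶ B₀} (w : αt ≫ fB = fA ≫ αb) [IsIso αt] [IsIso αb] (hA : E fA) :
    IsDoubleExtension E αt fA fB αb := by
  have hB : E fB := by
    rw [(IsIso.eq_inv_comp αt).2 w]
    exact hE.isIso_comp _ (hE.comp_isIso _ hA)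
  exact hE.isDoubleExtension (hE.of_isIso _ (hE.target hA)) hB
    (IsPullback.of_vert_isIso ⟨w.symm⟩)
    (Category.id_comp _) (Category.id_comp _) (hE.of_isIso _ (hE.source hA))

section

variable [HasPullbacks Y] {A₁ B₁ D₁ A₀ B₀ D₀ : Y} {αt : A₁ ⟶ B₁} {βt : B₁ ⟶ D₁} {fA : A₁ ⟶ A₀}
  {fB : B₁ ⟶ B₀} {fD : D₁ ⟶ D₀} {αb : A₀ ⟶ B₀} {βb : B₀ ⟶ D₀}

/-- The comparison map of the pasted square is `p`, the one for `α`, followed by `m`, a pullback of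
`q`, the one for `β`. -/
theorem isDoubleExtension_comp (hα : IsDoubleExtension E αt fA fB αb)
    (hβ : IsDoubleExtension E βt fB fD βb) :
    IsDoubleExtension E (αt ≫ βt) fA fD (αb ≫ βb) := by
  have hQ := IsPullback.of_hasPullback βb fD
  have hM := IsPullback.of_hasPullback αb fB
  have hQ' := IsPullback.of_hasPullback αb (pullback.fst βb fD)
  let q := hQ.lift fB βt hβ.comm.symm
  let p := hM.lift fA αt hα.comm.symm
  let m := hQ'.lift (pullback.fst αb fB) (pullback.snd αb fB ≫ q) (by simp [q, hM.w])
  have hq : E q := hE.comparison_mem hβ hQ (by simp [q]) (by simp [q])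
  have hp : E p := hE.comparison_mem hα hM (by simp [p]) (by simp [p])
  have hm : IsPullback m (pullback.snd αb fB) (pullback.snd αb (pullback.fst βb fD)) q :=
    IsPullback.of_right (by simpa [m, q] using hM) (by simp [m]) hQ'
  have hQ'O : O (pullback αb (pullback.fst βb fD)) :=
    hE.source (hE.pullback_fst hQ' (hE.pullback_fst hQ hβ.right_mem (hE.source hβ.bot_mem))
      (hE.source hα.bot_mem))
  exact hE.isDoubleExtension (hE.comp hα.bot_mem hβ.bot_mem) hβ.right_mem
    (hQ'.flip.paste_horiz hQ.flip).flip (p := p ≫ m) (by simp [p, m]) (by simp [p, m, q])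
    (hE.comp hp (hE.pullback_fst hm hq hQ'O))

/-- The comparison map `q` for `β`, precomposed with the extension `αt`, equals the comparison map
of the composite followed by a pullback of `αb`. This is an extension, so `αt` can be cancelled. -/
theorem isDoubleExtension_cancel (w : βt ≫ fD = fB ≫ βb) (hα : IsDoubleExtension E αt fA fB αb)
    (h : IsDoubleExtension E (αt ≫ βt) fA fD (αb ≫ βb)) : IsDoubleExtension E βt fB fD βb := by
  have hQ := IsPullback.of_hasPullback βb fD
  have hQ' := IsPullback.of_hasPullback αb (pullback.fst βb fD)
  have hb : E βb := hE.cancel hα.bot_mem h.bot_mem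
  let q := hQ.lift fB βt w.symm
  refine hE.isDoubleExtension (p := q) hb h.right_mem hQ (by simp [q]) (by simp [q])
    (hE.cancel hα.top_mem ?_)
  let p := hQ'.lift fA (αt ≫ q) (by simp [q, hα.comm])
  have hp : E p := hE.comparison_mem h (hQ'.flip.paste_horiz hQ.flip).flip
    (by simp [p]) (by simp [p, q])
  have : αt ≫ q = p ≫ pullback.snd αb (pullback.fst βb fD) := by simp [p]
  rw [this]
  exact hE.comp hp (hE.pullback_snd hQ' hα.bot_mem
    (hE.source (hE.pullback_fst hQ h.right_mem (hE.source hb))))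

/-- In the cube formed by the two pullback squares, the comparison map `c` of the new square is a
pullback of the comparison map `p` of `α`. -/
theorem isDoubleExtension_pullback {P₁ P₀ : Y} {xt : P₁ ⟶ D₁} {yt : P₁ ⟶ A₁} {xb : P₀ ⟶ D₀}
    {yb : P₀ ⟶ A₀} {fP : P₁ ⟶ P₀} {γt : D₁ ⟶ B₁} {γb : D₀ ⟶ B₀}
    (hα : IsDoubleExtension E αt fA fB αb) (hD : E fD) (ht : IsPullback xt yt γt αt)
    (hb : IsPullback xb yb γb αb) (wγ : γt ≫ fB = fD ≫ γb) (wx : xt ≫ fD = fP ≫ xb)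
    (wy : yt ≫ fA = fP ≫ yb) : IsDoubleExtension E xt fP fD xb := by
  have hM := IsPullback.of_hasPullback αb fB
  have hN := IsPullback.of_hasPullback xb fD
  have hxb : E xb := hE.pullback_fst hb hα.bot_mem (hE.target hD)
  let p := hM.lift fA αt hα.comm.symm
  have hp : E p := hE.comparison_mem hα hM (by simp [p]) (by simp [p])
  let n := hM.lift (pullback.fst xb fD ≫ yb) (pullback.snd xb fD ≫ γt)
    (by rw [Category.assoc, Category.assoc, ← hb.w, wγ, hN.w_assoc])
  let c := hN.lift fP xt wx.symm
  have hK : IsPullback n (pullback.snd xb fD) (pullback.snd αb fB) γt := by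
    refine IsPullback.of_right ?_ (by simp [n]) hM
    have := hN.paste_horiz hb.flip
    rwa [← wγ, ← hM.lift_fst (pullback.fst xb fD ≫ yb) (pullback.snd xb fD ≫ γt)] at this
  have hc : IsPullback yt c p n := by
    refine IsPullback.of_bot ?_ ?_ hK
    · simpa [c, p] using ht.flip
    · apply hM.hom_ext
      · simp [p, n, c, wy]
      · simp [p, n, c, ht.w]
  exact hE.isDoubleExtension hxb hD hN (p := c) (by simp [c]) (by simp [c])
    (hE.pullback_snd hc hp (hE.source (hE.pullback_fst hN hD (hE.source hxb))))

/-- Cover the codomain by a projective, pull `fB` back, and cover the pullback by a second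
projective, whose covering map is then the comparison map. -/
theorem exists_projective_doubleExtension (hB : E fB) :
    ∃ (Q₁ Q₀ : Y) (q : Q₁ ⟶ Q₀) (γt : Q₁ ⟶ B₁) (γb : Q₀ ⟶ B₀),
      IsProjectiveFor E Q₁ ∧ IsProjectiveFor E Q₀ ∧ IsDoubleExtension E γt q fB γb := by
  obtain ⟨Q₀, γb, hγb, hQ₀⟩ := hE.enough_projectives B₀ (hE.target hB)
  have hM := IsPullback.of_hasPullback γb fB
  obtain ⟨Q₁, p, hp, hQ₁⟩ := hE.enough_projectives (pullback γb fB)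
    (hE.source (hE.pullback_fst hM hB (hE.source hγb)))
  exact ⟨Q₁, Q₀, p ≫ pullback.fst _ _, p ≫ pullback.snd _ _, γb, hQ₁, hQ₀,
    hE.isDoubleExtension hγb hB hM rfl rfl hp⟩

end

/-- The double extensions form a class of extensions between the extensions. -/
theorem doubleExtensions [HasPullbacks Y] :
    IsExtensionClass (doubleExtensions E) (fun f : Arrow Y => E f.hom) where
  source _ _ _ hf := hf.left_mem
  target _ _ _ hf := hf.right_mem
  of_isIso _ _ f _ hA := hE.isDoubleExtension_of_isIso (Arrow.w f) hA
  comp _ _ _ _ _ hf hg := hE.isDoubleExtension_comp hf hg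
  cancel _ _ _ _ g hf hfg := hE.isDoubleExtension_cancel (Arrow.w g) hf hfg
  pullback_fst _ _ _ _ fst snd f _ hP hg hA :=
    hE.isDoubleExtension_pullback hg hA (arrow_isPullback_components hP).1
      (arrow_isPullback_components hP).2 (Arrow.w f) (Arrow.w fst) (Arrow.w snd)
  epi _ _ f hf := by
    have := hE.epi hf.top_mem
    have := hE.epi hf.bot_mem
    exact ⟨fun a b h => Arrow.hom_ext _ _
      ((cancel_epi f.left).1 (congrArg CommaMorphism.left h))
      ((cancel_epi f.right).1 (congrArg CommaMorphism.right h))⟩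
  desc _ _ _ _ f a b hf hab k hk := by
    obtain ⟨l₁, h₁⟩ := hE.desc hf.top_mem (arrow_isPullback_components hab).1 k.left
      (congrArg CommaMorphism.left hk)
    obtain ⟨l₀, h₀⟩ := hE.desc hf.bot_mem (arrow_isPullback_components hab).2 k.right
      (congrArg CommaMorphism.right hk)
    have := hE.epi hf.top_mem
    refine ⟨Arrow.homMk l₁ l₀ ?_, Arrow.hom_ext _ _ h₁ h₀⟩
    rw [← cancel_epi f.left, reassoc_of% h₁, Arrow.w k, ← h₀, ← Category.assoc, ← Arrow.w f,
      Category.assoc]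
  enough_projectives B hB := by
    obtain ⟨Q₁, Q₀, q, γt, γb, h₁, h₀, h⟩ := hE.exists_projective_doubleExtension hB
    refine ⟨Arrow.mk q, Arrow.homMk γt γb h.comm, h, fun A D e he b => ?_⟩
    obtain ⟨δt, δb, wδ, ht, hb⟩ := exists_lift_of_isDoubleExtension h₁ h₀ he (Arrow.w b)
    exact ⟨Arrow.homMk δt δb wδ, Arrow.hom_ext _ _ ht hb⟩

end IsExtensionClass

/-! ### Morphisms invertible away from the initial vertex -/

/-- Morphisms of arrows that are invertible at the codomain, and belong to `W` at the domain. -/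
def cornerMorphisms (W : MorphismProperty Y) : MorphismProperty (Arrow Y) :=
  fun _ _ α => IsIso α.right ∧ W α.left

namespace IsCornerClass

variable {E : MorphismProperty Y} {O : ObjectProperty Y} {V W : MorphismProperty Y}

/-- As `τb` is invertible, the pushout at the codomain can be taken to be `A₀`, so that only the
domain requires a construction. -/
theorem exists_square_pushout (hW : IsCornerClass E O V W) {X₁ T₁ A₁ X₀ T₀ A₀ : Y} {x : X₁ ⟶ X₀}
    {t : T₁ ⟶ T₀} {a : A₁ ⟶ A₀} {τt : X₁ ⟶ T₁} {τb : X₀ ⟶ T₀} {πt : X₁ ⟶ A₁} {πb : X₀ ⟶ A₀}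
    (wτ : τt ≫ t = x ≫ τb) (wπ : πt ≫ a = x ≫ πb) (hτt : W τt) [IsIso τb] (hπt : E πt) :
    ∃ (D₁ : Y) (d : D₁ ⟶ A₀) (r : T₁ ⟶ D₁) (h : A₁ ⟶ D₁), IsPushout τt πt r h ∧ W h ∧
      r ≫ d = t ≫ inv τb ≫ πb ∧ h ≫ d = a := by
  obtain ⟨D₁, r, h, hD, hh⟩ := hW.exists_pushout hτt hπt
  exact ⟨D₁, hD.desc (t ≫ inv τb ≫ πb) a (by rw [reassoc_of% wτ, IsIso.hom_inv_id_assoc, wπ]),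
    r, h, hD, hh, hD.inl_desc _ _ _, hD.inr_desc _ _ _⟩

/-- With `αb` invertible, `B₁` itself is the pullback and `αt` is the comparison map. -/
theorem isDoubleExtension_of_quotient (hW : IsCornerClass E O V W) (hE : IsExtensionClass E O)
    {A₁ B₁ A₀ B₀ : Y} {αt : A₁ ⟶ B₁} {fA : A₁ ⟶ A₀} {fB : B₁ ⟶ B₀} {αb : A₀ ⟶ B₀}
    (w : αt ≫ fB = fA ≫ αb) [IsIso αb] (ht : W αt) (hA : E fA) :
    IsDoubleExtension E αt fA fB αb := by
  have hB : E fB := hW.quotient_cancel ht (w ▸ hE.comp_isIso αb hA)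
  refine hE.isDoubleExtension (hE.of_isIso _ (hE.target hA)) hB (π₁ := fB ≫ inv αb) (π₂ := 𝟙 B₁)
    (IsPullback.of_vert_isIso ⟨by simp⟩) (p := αt) ?_ (Category.comp_id _)
    (hW.mem_of_quotient ht (hE.source hA))
  rw [reassoc_of% w, IsIso.hom_inv_id, Category.comp_id]

/-- With `αb` invertible, the composite and `β` share a pullback, and the comparison map of the
composite is `αt` followed by that of `β`. -/
theorem isDoubleExtension_cancel (hW : IsCornerClass E O V W) (hE : IsExtensionClass E O)
    {A₁ B₁ D₁ A₀ B₀ D₀ : Y} {αt : A₁ ⟶ B₁} {βt : B₁ ⟶ D₁} {fA : A₁ ⟶ A₀} {fB : B₁ ⟶ B₀}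
    {fD : D₁ ⟶ D₀} {αb : A₀ ⟶ B₀} {βb : B₀ ⟶ D₀} (wα : αt ≫ fB = fA ≫ αb)
    (wβ : βt ≫ fD = fB ≫ βb) [IsIso αb] (ht : W αt)
    (h : IsDoubleExtension E (αt ≫ βt) fA fD (αb ≫ βb)) : IsDoubleExtension E βt fB fD βb := by
  obtain ⟨Q, π₁, π₂, p, hQ, hp₁, hp₂, -, -, hp⟩ := h.comparison
  have hb : E βb := hE.cancel (hE.of_isIso αb (hE.source h.bot_mem)) h.bot_mem
  have hQ' : IsPullback (π₁ ≫ αb) π₂ βb fD := by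
    simpa using (hQ.flip.paste_vert (IsPullback.of_vert_isIso (fst := αb ≫ βb) (snd := αb)
      (f := 𝟙 _) (g := βb) ⟨by simp⟩)).flip
  refine hE.isDoubleExtension hb h.right_mem hQ' (p := hQ'.lift fB βt wβ.symm)
    (hQ'.lift_fst _ _ _) (hQ'.lift_snd _ _ _) (hW.quotient_cancel ht ?_)
  have : αt ≫ hQ'.lift fB βt wβ.symm = p := by
    apply hQ'.hom_ext
    · simp [wα, reassoc_of% hp₁]
    · simp [hp₂]
  rwa [this]

theorem cornerMorphisms (hW : IsCornerClass E O V W) (hE : IsExtensionClass E O)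
    [HasPullbacks Y] : IsCornerClass (doubleExtensions E) (fun f : Arrow Y => E f.hom)
      (cornerMorphisms V) (cornerMorphisms W) where
  of_isIso _ _ f _ := ⟨inferInstance, hW.of_isIso f.left⟩
  comp _ _ _ f g hf hg := by
    have := hf.1
    have := hg.1
    exact ⟨inferInstanceAs (IsIso (f.right ≫ g.right)), hW.comp hf.2 hg.2⟩
  cancel _ _ _ f g hfg hg := by
    have := hg.1
    have : IsIso (f.right ≫ g.right) := hfg.1
    exact ⟨IsIso.of_isIso_comp_right f.right g.right, hW.cancel hfg.2 hg.2⟩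
  pullback_fst _ _ _ _ _ _ _ _ hP hgE hg :=
    ⟨(arrow_isPullback_components hP).2.isIso_fst_of_isIso hg.1,
      hW.pullback_fst (arrow_isPullback_components hP).1 hgE.top_mem hg.2⟩
  quotient_of_mem _ _ _ hf hf' := ⟨hf.1, hW.quotient_of_mem hf.2 hf'.top_mem⟩
  of_quotient _ _ _ hf := ⟨hf.1, hW.of_quotient hf.2⟩
  mem_of_quotient _ _ f hf hA := by
    have := hf.1
    exact hW.isDoubleExtension_of_quotient hE (Arrow.w f) hf.2 hA
  quotient_cancel _ _ _ f g hf hfg := by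
    have := hf.1
    exact hW.isDoubleExtension_cancel hE (Arrow.w f) (Arrow.w g) hf.2 hfg
  exists_pushout X T A τ π hτ hπ := by
    have := hτ.1
    obtain ⟨D₁, d, r, h, hD, hh, hr, hd⟩ :=
      hW.exists_square_pushout (Arrow.w τ) (Arrow.w π) hτ.2 hπ.top_mem
    have hr' : IsPushout τ.right π.right (inv τ.right ≫ π.right) (𝟙 A.right) :=
      IsPushout.of_horiz_isIso ⟨by simp⟩
    exact ⟨Arrow.mk d, Arrow.homMk r (inv τ.right ≫ π.right) hr,
      Arrow.homMk h (𝟙 A.right) (hd.trans (Category.comp_id _).symm),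
      arrow_isPushout_of_components hD hr',
      inferInstanceAs (IsIso (𝟙 A.right)), hh⟩

end IsCornerClass

end ExtensionClasses

/-! ### Regular epimorphisms in a regular category -/

section RegularEpis

variable {C : Type w} [Category.{w'} C] [Regular C]

theorem isRegularEpi_of_strongEpi {A B : C} (f : A ⟶ B) [StrongEpi f] : IsRegularEpi f :=
  inferInstance

theorem isRegularEpi_cancel {A B D : C} (f : A ⟶ B) (g : B ⟶ D) [IsRegularEpi (f ≫ g)] :
    IsRegularEpi g :=
  have := strongEpi_of_strongEpi f g
  isRegularEpi_of_strongEpi g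

theorem exists_jointly_mono_factorisation {R T : C} (a b : R ⟶ T) :
    ∃ (S : C) (e : R ⟶ S) (s₁ s₂ : S ⟶ T), IsRegularEpi e ∧ e ≫ s₁ = a ∧ e ≫ s₂ = b ∧
      ∀ ⦃Z : C⦄ (x y : Z ⟶ S), x ≫ s₁ = y ≫ s₁ → x ≫ s₂ = y ≫ s₂ → x = y := by
  let F := Regular.strongEpiMonoFactorisation (prod.lift a b)
  refine ⟨F.I, F.e, F.m ≫ prod.fst, F.m ≫ prod.snd, isRegularEpi_of_strongEpi F.e, ?_, ?_, ?_⟩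
  · rw [← Category.assoc, F.fac, prod.lift_fst]
  · rw [← Category.assoc, F.fac, prod.lift_snd]
  · intro Z x y h₁ h₂
    rw [← cancel_mono F.m]
    exact prod.hom_ext (by simpa using h₁) (by simpa using h₂)

/-- Pushouts of regular epimorphisms in a regular category with reflexive coequalisers. -/
theorem exists_isPushout_of_isRegularEpi [HasReflexiveCoequalizers C] {X T A : C} (τ : X ⟶ T)
    (π : X ⟶ A) [IsRegularEpi τ] [IsRegularEpi π] :
    ∃ (D : C) (r : T ⟶ D) (h : A ⟶ D), IsPushout τ π r h ∧ IsRegularEpi h := by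
  have hπ : IsKernelPair π _ _ := IsKernelPair.of_hasPullback π
  have hτ : IsKernelPair τ _ _ := IsKernelPair.of_hasPullback τ
  -- The kernel pair of `π`, mapped to `T`, need not be a reflexive pair. Its image `S` in `T × T`
  -- has the same coequaliser and is reflexive.
  obtain ⟨S, e, s₁, s₂, he, h₁, h₂, hS⟩ :=
    exists_jointly_mono_factorisation (pullback.fst π π ≫ τ) (pullback.snd π π ≫ τ)
  let δ : X ⟶ pullback π π := hπ.lift (𝟙 X) (𝟙 X) rfl
  have hδ₁ : δ ≫ e ≫ s₁ = τ := by rw [h₁, hπ.lift_fst_assoc, Category.id_comp]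
  have hδ₂ : δ ≫ e ≫ s₂ = τ := by rw [h₂, hπ.lift_snd_assoc, Category.id_comp]
  -- The diagonal of `X` descends along `τ` to a common section of `s₁` and `s₂`, because these are
  -- jointly monic.
  obtain ⟨σ, hσ⟩ := IsRegularEpi.exists_of_isKernelPair τ hτ (δ ≫ e)
    (hS _ _ (by simp only [Category.assoc, hδ₁, hτ.w]) (by simp only [Category.assoc, hδ₂, hτ.w]))
  have hσ₁ : σ ≫ s₁ = 𝟙 T := by
    rw [← cancel_epi τ, reassoc_of% hσ, hδ₁, Category.comp_id]
  have hσ₂ : σ ≫ s₂ = 𝟙 T := by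
    rw [← cancel_epi τ, reassoc_of% hσ, hδ₂, Category.comp_id]
  have : HasCoequalizer s₁ s₂ := hasCoequalizer_of_common_section C σ hσ₁ hσ₂
  let r := coequalizer.π s₁ s₂
  have hr : s₁ ≫ r = s₂ ≫ r := coequalizer.condition _ _
  obtain ⟨h, hh⟩ := IsRegularEpi.exists_of_isKernelPair π hπ (τ ≫ r) (by
    rw [← reassoc_of% h₁, ← reassoc_of% h₂, hr])
  refine ⟨_, r, h, IsPushout.mk' hh.symm ?_ ?_, ?_⟩
  · intro Z φ φ' h₁ _
    exact (cancel_epi r).1 h₁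
  · intro Z a b hab
    have ha : s₁ ≫ a = s₂ ≫ a := by
      rw [← cancel_epi e, reassoc_of% h₁, reassoc_of% h₂, hab, hπ.w_assoc]
    have hra : r ≫ coequalizer.desc a ha = a := coequalizer.π_desc _ _
    refine ⟨coequalizer.desc a ha, hra, ?_⟩
    rw [← cancel_epi π, reassoc_of% hh, hra, hab]
  · have : StrongEpi (π ≫ h) := hh ▸ strongEpi_comp τ r
    have := strongEpi_of_strongEpi π h
    exact isRegularEpi_of_strongEpi h

theorem isExtensionClass_regularEpi [EnoughRegularProjectives C] :
    IsExtensionClass (MorphismProperty.regularEpi C) (fun _ => True) where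
  source _ _ _ _ := trivial
  target _ _ _ _ := trivial
  of_isIso _ _ f _ _ := inferInstanceAs (IsRegularEpi f)
  comp _ _ _ f g hf hg := by
    have : IsRegularEpi f := hf
    have : IsRegularEpi g := hg
    have := strongEpi_comp f g
    exact isRegularEpi_of_strongEpi (f ≫ g)
  cancel _ _ _ f g _ hfg := by
    have : IsRegularEpi (f ≫ g) := hfg
    exact isRegularEpi_cancel f g
  pullback_fst _ _ _ _ _ _ _ _ hP hg _ :=
    Regular.regularEpiIsStableUnderBaseChange.of_isPullback hP.flip hg
  epi _ _ f hf := by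
    have : IsRegularEpi f := hf
    infer_instance
  desc _ _ _ _ f _ _ hf hab k hk := by
    have : IsRegularEpi f := hf
    exact IsRegularEpi.exists_of_isKernelPair f hab k hk
  enough_projectives B _ := EnoughRegularProjectives.presentation B

/-- A cube of dimension zero has only its initial vertex, so invertibility elsewhere is no
condition. -/
theorem isCornerClass_regularEpi [HasReflexiveCoequalizers C] :
    IsCornerClass (MorphismProperty.regularEpi C) (fun _ => True) ⊤
      (MorphismProperty.regularEpi C) where
  of_isIso _ _ _ _ := trivial
  comp _ _ _ _ _ _ _ := trivial
  cancel _ _ _ _ _ _ _ := trivial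
  pullback_fst _ _ _ _ _ _ _ _ _ _ _ := trivial
  quotient_of_mem _ _ _ _ hf := hf
  of_quotient _ _ _ _ := trivial
  mem_of_quotient _ _ _ hf _ := hf
  quotient_cancel _ _ _ f g _ hfg := by
    have : IsRegularEpi (f ≫ g) := hfg
    exact isRegularEpi_cancel f g
  exists_pushout _ _ _ τ π hτ hπ := by
    have : IsRegularEpi τ := hτ
    have : IsRegularEpi π := hπ
    exact exists_isPushout_of_isRegularEpi τ π

end RegularEpis

/-! ### The axioms on iterated arrow categories -/

section ArrowTower

variable (C : Type (max u v)) [Category.{v} C]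

/-- The morphisms of `n`-fold arrows that are invertible away from the initial vertex, where they
belong to the class `W`. -/
def corner (W : MorphismProperty C) : (n : ℕ) → MorphismProperty (arr.{v, u} C n)
  | 0 => W
  | n + 1 => cornerMorphisms (corner W n)

theorem hasPullbacks_arr [HasPullbacks C] : ∀ n : ℕ, HasPullbacks (arr.{v, u} C n)
  | 0 => inferInstanceAs (HasPullbacks C)
  | n + 1 =>
    have := hasPullbacks_arr n
    inferInstanceAs (HasPullbacks (Arrow (arr.{v, u} C n)))

variable [Regular C] [EnoughRegularProjectives C]

theorem isExtensionClass_ext : ∀ n : ℕ, IsExtensionClass (ext.{v, u} C n) (isExt.{v, u} C n)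
  | 0 => isExtensionClass_regularEpi (C := C)
  | n + 1 =>
    have := hasPullbacks_arr.{v, u} C n
    (isExtensionClass_ext n).doubleExtensions

theorem isCornerClass_corner [HasReflexiveCoequalizers C] : ∀ n : ℕ,
    IsCornerClass (ext.{v, u} C n) (isExt.{v, u} C n) (corner.{v, u} C ⊤ n)
      (corner.{v, u} C (MorphismProperty.regularEpi C) n)
  | 0 => isCornerClass_regularEpi (C := C)
  | n + 1 =>
    have := hasPullbacks_arr.{v, u} C n
    (isCornerClass_corner n).cornerMorphisms (isExtensionClass_ext C n)

end ArrowTower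

/-! ### Restriction to the full subcategory of extensions -/

section FullSubcategories

variable {Y : Type w} [Category.{w'} Y] {E : MorphismProperty Y} {O : ObjectProperty Y}
  (hE : IsExtensionClass E O) [HasPullbacks Y]

namespace IsExtensionClass

include hE

/-- The pullback stays in the subcategory because its vertex is the domain of an extension. -/
theorem exists_isPullback_fullSubcategory {A B D : O.FullSubcategory} (f : A ⟶ B) (g : D ⟶ B)
    (hg : E g.hom) : ∃ (P : O.FullSubcategory) (fst : P ⟶ A) (snd : P ⟶ D),
      IsPullback fst snd f g ∧ IsPullback fst.hom snd.hom f.hom g.hom := by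
  have h := IsPullback.of_hasPullback f.hom g.hom
  let P : O.FullSubcategory := ⟨pullback f.hom g.hom, hE.source (hE.pullback_fst h hg A.property)⟩
  exact ⟨P, ObjectProperty.homMk (pullback.fst f.hom g.hom),
    ObjectProperty.homMk (pullback.snd f.hom g.hom),
    IsPullback.of_map_of_faithful O.ι h, h⟩

theorem isPullback_hom {P A B D : O.FullSubcategory} {fst : P ⟶ A} {snd : P ⟶ D} {f : A ⟶ B}
    {g : D ⟶ B} (h : IsPullback fst snd f g) (hg : E g.hom) :
    IsPullback fst.hom snd.hom f.hom g.hom := by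
  obtain ⟨Q, q₁, q₂, hQ, hQ'⟩ := hE.exists_isPullback_fullSubcategory f g hg
  exact hQ'.of_iso (O.ι.mapIso (h.isoIsPullback _ _ hQ).symm) (Iso.refl _) (Iso.refl _)
    (Iso.refl _)
    ((Category.comp_id _).trans (congrArg O.ι.map (h.isoIsPullback_inv_fst _ _ hQ)).symm)
    ((Category.comp_id _).trans (congrArg O.ι.map (h.isoIsPullback_inv_snd _ _ hQ)).symm)
    (by simp) (by simp)

theorem fullSubcategory : IsExtensionClass (E.inverseImage O.ι) (fun _ => True) where
  source _ _ _ _ := trivial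
  target _ _ _ _ := trivial
  of_isIso A _ f _ _ := hE.of_isIso (O.ι.map f) A.property
  comp _ _ _ _ _ hf hg := hE.comp hf hg
  cancel _ _ _ _ _ hf hfg := hE.cancel hf hfg
  pullback_fst _ A _ _ _ _ _ _ hP hg _ := hE.pullback_fst (hE.isPullback_hom hP hg) hg A.property
  epi _ _ f hf := by
    have : Epi (O.ι.map f) := hE.epi hf
    exact O.ι.epi_of_epi_map this
  desc _ _ _ _ f a b hf hab k hk := by
    obtain ⟨l, hl⟩ := hE.desc hf (hE.isPullback_hom hab hf) k.hom (congrArg O.ι.map hk)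
    exact ⟨ObjectProperty.homMk l, O.ι.map_injective hl⟩
  enough_projectives B _ := by
    obtain ⟨P, p, hp, hP⟩ := hE.enough_projectives B.obj B.property
    refine ⟨⟨P, hE.source hp⟩, ObjectProperty.homMk p, hp, fun A D e he b => ?_⟩
    obtain ⟨a, ha⟩ := hP e.hom he b.hom
    exact ⟨ObjectProperty.homMk a, O.ι.map_injective ha⟩

end IsExtensionClass

theorem IsCornerClass.fullSubcategory {V W : MorphismProperty Y} (hW : IsCornerClass E O V W)
    (hE : IsExtensionClass E O) :
    IsCornerClass (E.inverseImage O.ι) (fun _ => True) (V.inverseImage O.ι)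
      (W.inverseImage O.ι) where
  of_isIso _ _ f _ := hW.of_isIso (O.ι.map f)
  comp _ _ _ _ _ hf hg := hW.comp hf hg
  cancel _ _ _ _ _ hfg hg := hW.cancel hfg hg
  pullback_fst _ _ _ _ _ _ _ _ hP hgE hg := hW.pullback_fst (hE.isPullback_hom hP hgE) hgE hg
  quotient_of_mem _ _ _ hf hf' := hW.quotient_of_mem hf hf'
  of_quotient _ _ _ hf := hW.of_quotient hf
  mem_of_quotient A _ _ hf _ := hW.mem_of_quotient hf A.property
  quotient_cancel _ _ _ _ _ hf hfg := hW.quotient_cancel hf hfg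
  exists_pushout X T A τ π hτ hπ := by
    obtain ⟨D, r, h, hD, hh⟩ := hW.exists_pushout hτ hπ
    exact ⟨⟨D, hE.target (hW.mem_of_quotient hh A.property)⟩, ObjectProperty.homMk r,
      ObjectProperty.homMk h, IsPushout.of_map_of_faithful O.ι hD, hh⟩

end FullSubcategories

/-! ### Trivial coverings of a strongly Birkhoff reflection -/

/-- Pullbacks along extensions exist. -/
def HasExtensionPullbacks {Y : Type w} [Category.{w'} Y] (E : MorphismProperty Y) : Prop :=
  ∀ ⦃A B D : Y⦄ (f : A ⟶ B) (g : D ⟶ B), E g →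
    ∃ (P : Y) (fst : P ⟶ A) (snd : P ⟶ D), IsPullback fst snd f g

namespace GaloisStructure

variable {Y : Type w} [Category.{w'} Y] {E : MorphismProperty Y} (Γ : GaloisStructure E)

theorem η_naturality {A B : Y} (f : A ⟶ B) : Γ.η A ≫ Γ.reflMap f = f ≫ Γ.η B :=
  (Γ.adj.unit.naturality f).symm

theorem exists_desc {A W : Y} (hW : Γ.X W) (f : A ⟶ W) : ∃ g : Γ.refl A ⟶ W, Γ.η A ≫ g = f :=
  ⟨((Γ.adj.homEquiv A ⟨W, hW⟩).symm f).hom,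
    (Γ.adj.homEquiv_unit ..).symm.trans ((Γ.adj.homEquiv A ⟨W, hW⟩).apply_symm_apply f)⟩

theorem refl_hom_ext {A W : Y} (hW : Γ.X W) {f g : Γ.refl A ⟶ W} (h : Γ.η A ≫ f = Γ.η A ≫ g) :
    f = g := by
  have : (ObjectProperty.homMk f : Γ.L.obj A ⟶ ⟨W, hW⟩) = ObjectProperty.homMk g := by
    apply (Γ.adj.homEquiv A ⟨W, hW⟩).injective
    exact (Γ.adj.homEquiv_unit A ⟨W, hW⟩ _).trans
      (h.trans (Γ.adj.homEquiv_unit A ⟨W, hW⟩ (ObjectProperty.homMk g)).symm)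
  exact congrArg Γ.X.ι.map this

theorem refl_mem (A : Y) : Γ.X (Γ.refl A) := (Γ.L.obj A).property

/-- A reflective subcategory is closed under pullbacks. -/
theorem mem_of_isPullback {P A B D : Y} {fst : P ⟶ A} {snd : P ⟶ D} {f : A ⟶ B} {g : D ⟶ B}
    (h : IsPullback fst snd f g) (hA : Γ.X A) (hD : Γ.X D) (hB : Γ.X B) : Γ.X P := by
  obtain ⟨a, ha⟩ := Γ.exists_desc hA fst
  obtain ⟨d, hd⟩ := Γ.exists_desc hD snd
  have had : a ≫ f = d ≫ g := Γ.refl_hom_ext hB (by rw [reassoc_of% ha, reassoc_of% hd, h.w])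
  -- The unit at `P` has a retraction, which is a two-sided inverse by uniqueness of maps out of the
  -- reflection.
  have hm : Γ.η P ≫ h.lift a d had = 𝟙 P := h.hom_ext (by simp [ha]) (by simp [hd])
  have hm' : h.lift a d had ≫ Γ.η P = 𝟙 _ :=
    Γ.refl_hom_ext (Γ.refl_mem P) (by rw [reassoc_of% hm, Category.comp_id])
  exact Γ.replete.of_iso ⟨_, _, hm', hm⟩ (Γ.refl_mem P)

variable {Γ} (hE : IsExtensionClass E (fun _ => True)) (hΓ : Γ.StronglyBirkhoff)

theorem isPullback_isIso_comp {Q P A B D : Y} {fst : P ⟶ A} {snd : P ⟶ D} {f : A ⟶ B}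
    {g : D ⟶ B} (h : IsPullback fst snd f g) (p : Q ⟶ P) [IsIso p] :
    IsPullback (p ≫ fst) (p ≫ snd) f g :=
  h.of_iso (asIso p).symm (Iso.refl _) (Iso.refl _) (Iso.refl _) (by simp) (by simp) (by simp)
    (by simp)

include hE hΓ

/-- The comparison map of the reflection square is an extension. As `a` factors through the unit,
the given pullback supplies a retraction of it, so it is invertible. -/
theorem trivialCovering_of_isPullback {S T W : Y} {φ : W ⟶ Γ.refl S} (hW : Γ.X W) (hφ : E φ)
    {a : T ⟶ W} {t : T ⟶ S} (h : IsPullback a t φ (Γ.η S)) : Γ.trivialCovering t := by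
  have ht : E t := hE.pullback_snd h hφ trivial
  obtain ⟨Q, π₁, π₂, p, hQ, hp₁, hp₂, -, -, hp⟩ := (hΓ t ht).comparison
  obtain ⟨m, hm⟩ := Γ.exists_desc hW a
  have hmφ : m ≫ φ = Γ.reflMap t := Γ.refl_hom_ext (Γ.refl_mem S)
    (by rw [reassoc_of% hm, h.w, Γ.η_naturality])
  have hρ : p ≫ h.lift (π₂ ≫ m) π₁ (by rw [Category.assoc, hmφ, hQ.w]) = 𝟙 T :=
    h.hom_ext (by simp [reassoc_of% hp₂, hm]) (by simp [hp₁])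
  have := hE.isIso_of_retraction hp _ hρ
  refine ⟨ht, ?_⟩
  have := isPullback_isIso_comp hQ.flip p
  rwa [hp₁, hp₂] at this

theorem Trivialisation.map_trivialCovering {A B : Y} {f : A ⟶ B} (T : Γ.Trivialisation f)
    (hf : E f) : Γ.trivialCovering T.map :=
  trivialCovering_of_isPullback hE hΓ (Γ.refl_mem A) (hΓ f hf).right_mem T.isPullback

theorem Trivialisation.τ_mem {A B : Y} {f : A ⟶ B} (T : Γ.Trivialisation f) (hf : E f) :
    E T.τ :=
  hE.comparison_mem (hΓ f hf) T.isPullback.flip T.τ_map T.τ_toRefl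

variable (hP : HasExtensionPullbacks E)

include hP

/-- A quotient of a trivial covering by an extension is a trivial covering. -/
theorem trivialCovering_of_quotient {T T' S : Y} {e : T ⟶ T'} {t' : T' ⟶ S} (he : E e)
    (ht : Γ.trivialCovering (e ≫ t')) : Γ.trivialCovering t' := by
  have ht' : E t' := hE.cancel he ht.1
  -- The comparison map of this square is an extension, and the pullback property of the square of
  -- `e ≫ t'` splits it.
  have hTe : IsPullback e (Γ.η T) (Γ.η T') (Γ.reflMap e) := by
    obtain ⟨K, κ₁, κ₂, c, hK, hc₁, hc₂, -, -, hc⟩ := (hΓ e he).comparison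
    have hw : κ₂ ≫ Γ.reflMap (e ≫ t') = (κ₁ ≫ t') ≫ Γ.η S := by
      rw [Category.assoc, ← Γ.η_naturality, hK.w_assoc]
      simp
    have := hE.isIso_of_retraction hc (ht.2.lift κ₂ (κ₁ ≫ t') hw)
      (ht.2.hom_ext (by simp [hc₂]) (by simp [reassoc_of% hc₁]))
    have := isPullback_isIso_comp hK c
    rwa [hc₁, hc₂] at this
  obtain ⟨Q, π₁, π₂, p, hQ, hp₁, hp₂, -, -, hp⟩ := (hΓ t' ht').comparison
  have hw : E (e ≫ p) := hE.comp he hp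
  obtain ⟨R, a, b, hR⟩ := hP (e ≫ p) (e ≫ p) hw
  -- The kernel pair of `e ≫ p` is already coequalised by `e`, so `e` factors through `e ≫ p` and
  -- `p` acquires a retraction. To compare, take the map to `T` that agrees with `b` after `e` and
  -- with `a` after the unit; it equals `a` because `e ≫ t'` is a trivial covering.
  have hab : a ≫ e = b ≫ e := by
    have h₁ : (b ≫ e) ≫ Γ.η T' = (a ≫ Γ.η T) ≫ Γ.reflMap e := by
      rw [Category.assoc a, Γ.η_naturality, Category.assoc, ← hp₂]
      simpa using (hR.w =≫ π₂).symm
    have h₂ : hTe.lift (b ≫ e) (a ≫ Γ.η T) h₁ = a := by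
      apply ht.2.hom_ext
      · simp
      · rw [hTe.lift_fst_assoc, ← hp₁]
        simpa using (hR.w =≫ π₁).symm
    rw [← h₂, hTe.lift_fst]
  obtain ⟨m, hm⟩ := hE.desc hw hR e hab
  have := hE.epi he
  have := hE.isIso_of_retraction hp m
    (by rw [← cancel_epi e, ← Category.assoc, hm, Category.comp_id])
  refine ⟨ht', ?_⟩
  have := isPullback_isIso_comp hQ.flip p
  rwa [hp₁, hp₂] at this

/-- Trivial coverings are stable under pullback. -/
theorem trivialCovering_pullback {S S' T T' : Y} {t : T ⟶ S} (ht : Γ.trivialCovering t)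
    {u : S' ⟶ S} {a : T' ⟶ T} {t' : T' ⟶ S'} (h : IsPullback a t' t u) :
    Γ.trivialCovering t' := by
  have hFt := (hΓ t ht.1).right_mem
  -- The pullback of the reflections lies in the subcategory, and `T'` is its pullback along the
  -- unit at `S'`.
  obtain ⟨W, w₁, w₂, hW⟩ := hP (Γ.reflMap u) (Γ.reflMap t) hFt
  refine trivialCovering_of_isPullback hE hΓ
    (Γ.mem_of_isPullback hW (Γ.refl_mem _) (Γ.refl_mem _) (Γ.refl_mem _))
    (hE.pullback_fst hW hFt trivial)
    (a := hW.lift (t' ≫ Γ.η S') (a ≫ Γ.η T) ?_) (IsPullback.of_right ?_ ?_ hW.flip)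
  · rw [Category.assoc, Γ.η_naturality, Category.assoc, Γ.η_naturality, h.w_assoc]
  · rw [hW.lift_snd, Γ.η_naturality]
    exact h.paste_horiz ht.2
  · simp

omit hE in
theorem exists_trivialisation {A B : Y} {f : A ⟶ B} (hf : E f) :
    Nonempty (Γ.Trivialisation f) := by
  obtain ⟨T, t₁, t₂, hT⟩ := hP (Γ.η B) (Γ.reflMap f) (hΓ f hf).right_mem
  exact ⟨⟨T, t₁, t₂, hT.flip, hT.lift f (Γ.η A) (Γ.η_naturality f).symm, by simp, by simp⟩⟩

end GaloisStructure

/-! ### The reflection of an extension into coverings -/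

namespace GaloisStructure

variable {Y : Type w} [Category.{w'} Y] {E : MorphismProperty Y} {Γ : GaloisStructure E}

/-- A morphism from `A` to a trivial covering of `B` factors through the trivialisation. -/
theorem Trivialisation.exists_factorisation {A B : Y} {f : A ⟶ B} (T : Γ.Trivialisation f)
    {S : Y} {t : S ⟶ B} (ht : Γ.trivialCovering t) (k : A ⟶ S) (hk : k ≫ t = f) :
    ∃ l : T.obj ⟶ S, T.τ ≫ l = k ∧ l ≫ t = T.map := by
  subst hk
  have hw : (T.toRefl ≫ Γ.reflMap k) ≫ Γ.reflMap t = T.map ≫ Γ.η B := by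
    rw [Category.assoc, ← T.isPullback.w]
    simp
  refine ⟨ht.2.lift (T.toRefl ≫ Γ.reflMap k) T.map hw, ht.2.hom_ext ?_ ?_, ht.2.lift_snd _ _ _⟩
  · rw [Category.assoc, ht.2.lift_fst, ← Category.assoc, T.τ_toRefl, Γ.η_naturality]
  · rw [Category.assoc, ht.2.lift_snd, T.τ_map]

namespace TrivialisedPresentation

variable {A B : Y} {f : A ⟶ B} (D : Γ.TrivialisedPresentation f)

/-- This makes `fhat` an extension, as a pullback of `πP`; it follows by pasting the kernel pair
squares with the square that defines `X`. -/
theorem isPullback_fhat : IsPullback D.fhat D.d₁ D.q₁ D.πP := by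
  refine IsPullback.of_right ?_ D.fhat_q₁ D.isKernelPair_p.flip
  rw [D.fhat_q₂, ← D.isPullback.w]
  exact D.isKernelPair_πA.flip.paste_horiz D.isPullback.flip

theorem τ_π₁ : D.trivR.τ ≫ D.π₁ = D.d₁ ≫ D.trivX.τ := by
  apply D.trivX.isPullback.hom_ext
  · rw [Category.assoc, D.π₁_toRefl, ← Category.assoc, D.trivR.τ_toRefl, Category.assoc,
      D.trivX.τ_toRefl, Γ.η_naturality]
  · rw [Category.assoc, D.π₁_map, ← Category.assoc, D.trivR.τ_map, Category.assoc,
      D.trivX.τ_map, D.fhat_q₁]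

theorem τ_π₂ : D.trivR.τ ≫ D.π₂ = D.d₂ ≫ D.trivX.τ := by
  apply D.trivX.isPullback.hom_ext
  · rw [Category.assoc, D.π₂_toRefl, ← Category.assoc, D.trivR.τ_toRefl, Category.assoc,
      D.trivX.τ_toRefl, Γ.η_naturality]
  · rw [Category.assoc, D.π₂_map, ← Category.assoc, D.trivR.τ_map, Category.assoc,
      D.trivX.τ_map, D.fhat_q₂]

end TrivialisedPresentation

section

variable (hE : IsExtensionClass E (fun _ => True)) (hP : HasExtensionPullbacks E)
  (hΓ : Γ.StronglyBirkhoff)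

include hE hP hΓ

theorem exists_trivialisedPresentation {A B : Y} {f : A ⟶ B} (hf : E f) :
    Nonempty (Γ.TrivialisedPresentation f) := by
  obtain ⟨P, p, hp, hPproj⟩ := hE.enough_projectives B trivial
  obtain ⟨X, πA, πP, hX⟩ := hP f p hp
  have hπA : E πA := hE.pullback_fst hX hp trivial
  have hπP : E πP := hE.pullback_snd hX hf trivial
  obtain ⟨R, d₁, d₂, hR⟩ := hP πA πA hπA
  obtain ⟨Q, q₁, q₂, hQ⟩ := hP p p hp
  have hw : (d₁ ≫ πP) ≫ p = (d₂ ≫ πP) ≫ p := by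
    rw [Category.assoc, Category.assoc, ← hX.w, hR.w_assoc]
  let fhat : R ⟶ Q := hQ.lift (d₁ ≫ πP) (d₂ ≫ πP) hw
  have h₁ : fhat ≫ q₁ = d₁ ≫ πP := hQ.lift_fst _ _ _
  have h₂ : fhat ≫ q₂ = d₂ ≫ πP := hQ.lift_snd _ _ _
  have hfhat : E fhat := by
    refine hE.pullback_fst (IsPullback.of_right ?_ h₁ hQ.flip) hπP trivial
    rw [h₂, ← hX.w]
    exact hR.flip.paste_horiz hX.flip
  obtain ⟨TX⟩ := exists_trivialisation hΓ hP hπP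
  obtain ⟨TR⟩ := exists_trivialisation hΓ hP hfhat
  have e₁ : (TR.toRefl ≫ Γ.reflMap d₁) ≫ Γ.reflMap πP = (TR.map ≫ q₁) ≫ Γ.η P := by
    rw [Category.assoc, Category.assoc, ← Γ.η_naturality, ← TR.isPullback.w_assoc,
      ← Functor.map_comp, ← Functor.map_comp, ← Functor.map_comp, ← Functor.map_comp, h₁]
  have e₂ : (TR.toRefl ≫ Γ.reflMap d₂) ≫ Γ.reflMap πP = (TR.map ≫ q₂) ≫ Γ.η P := by
    rw [Category.assoc, Category.assoc, ← Γ.η_naturality, ← TR.isPullback.w_assoc,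
      ← Functor.map_comp, ← Functor.map_comp, ← Functor.map_comp, ← Functor.map_comp, h₂]
  exact ⟨{ P := P, p := p, p_mem := hp, projective := hPproj, X := X, πA := πA, πP := πP
           isPullback := hX, R := R, d₁ := d₁, d₂ := d₂, isKernelPair_πA := hR
           Q := Q, q₁ := q₁, q₂ := q₂, isKernelPair_p := hQ, fhat := fhat
           fhat_q₁ := h₁, fhat_q₂ := h₂, trivX := TX, trivR := TR
           π₁ := TX.isPullback.lift _ _ e₁
           π₂ := TX.isPullback.lift _ _ e₂
           π₁_map := TX.isPullback.lift_snd _ _ e₁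
           π₁_toRefl := TX.isPullback.lift_fst _ _ e₁
           π₂_map := TX.isPullback.lift_snd _ _ e₂
           π₂_toRefl := TX.isPullback.lift_fst _ _ e₂ }⟩

variable {A B : Y} {f : A ⟶ B} (D : Γ.TrivialisedPresentation f)

/-- Any morphism from `f` to a covering factors, on domains, through the trivialisation of the
pullback of `f` along a projective presentation. -/
theorem TrivialisedPresentation.exists_factorisation {S S' : Y} {c : S ⟶ S'}
    (hc : Γ.covering c) (a : A ⟶ S) (b : B ⟶ S') (hab : a ≫ c = f ≫ b) :
    ∃ k : D.trivX.obj ⟶ S, D.trivX.τ ≫ k = D.πA ≫ a := by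
  obtain ⟨hcE, U, T, e, t, x, he, hT, ht⟩ := hc
  -- The lift through the splitting extension `e` makes the pullback of `c` along `D.p ≫ b` a
  -- pullback of the trivial covering `t`.
  obtain ⟨s, hs⟩ := D.projective e he (D.p ≫ b)
  obtain ⟨T', t', y, hT'⟩ := hP s t ht.1
  have ht' : Γ.trivialCovering t' := trivialCovering_pullback hE hΓ hP ht hT'.flip
  have hK : IsPullback (y ≫ x) t' c (D.p ≫ b) := by
    rw [← hs]
    exact hT'.flip.paste_horiz hT
  have hw : (D.πA ≫ a) ≫ c = D.πP ≫ D.p ≫ b := by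
    rw [Category.assoc, hab, ← Category.assoc, D.isPullback.w, Category.assoc]
  obtain ⟨l, hl, -⟩ := D.trivX.exists_factorisation ht' (hK.lift (D.πA ≫ a) D.πP hw)
    (hK.lift_snd _ _ _)
  exact ⟨l ≫ y ≫ x, by rw [reassoc_of% hl, hK.lift_fst]⟩

/-- The pushout of the comparison map `τ` of `πP` along `πA` gives the reflection of `f` into
coverings. -/
theorem TrivialisedPresentation.isCoveringReflection (hf : E f) {A' : Y}
    {r : D.trivX.obj ⟶ A'} {h : A ⟶ A'} {g : A' ⟶ B} (hpo : IsPushout D.trivX.τ D.πA r h)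
    (hg : E g) (hh : E h) (hrg : r ≫ g = D.trivX.map ≫ D.p) (hhg : h ≫ g = f) :
    Γ.IsCoveringReflection f h g := by
  have hπP : E D.πP := hE.pullback_snd D.isPullback hf trivial
  have hτ : E D.trivX.τ := D.trivX.τ_mem hE hΓ hπP
  have := hE.epi hh
  refine ⟨hhg, ⟨hg, ?_⟩, ?_⟩
  · obtain ⟨K, k₁, k₂, hK⟩ := hP D.p g hg
    let e := hK.lift D.trivX.map r hrg.symm
    have he₁ : e ≫ k₁ = D.trivX.map := hK.lift_fst _ _ _
    have he₂ : e ≫ k₂ = r := hK.lift_snd _ _ _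
    -- The composite of `τ` with `e` is the pullback of `h` along `k₂`, since `X` and `K` are the
    -- pullbacks of `f` and `g` along `p`; the extension `τ` is then cancelled.
    have he : E e := by
      refine hE.cancel hτ (hE.pullback_fst (IsPullback.of_right (v₁₁ := D.πA) (h₂₁ := h) ?_ ?_ hK)
        hh trivial)
      · rw [Category.assoc, he₁, D.trivX.τ_map, hhg]
        exact D.isPullback.flip
      · rw [Category.assoc, he₂, hpo.w]
    refine ⟨D.P, K, D.p, k₁, k₂, D.p_mem, hK.flip,
      trivialCovering_of_quotient hE hΓ hP he ?_⟩
    rw [he₁]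
    exact D.trivX.map_trivialCovering hE hΓ hπP
  · intro S S' c hc a b hab
    obtain ⟨k, hk⟩ := D.exists_factorisation hE hP hΓ hc a b hab
    refine ⟨hpo.desc k a hk, ⟨hpo.inr_desc _ _ _, ?_⟩, fun x hx => ?_⟩
    · rw [← cancel_epi h, hpo.inr_desc_assoc, hab, reassoc_of% hhg]
    · rw [← cancel_epi h, hx.1, hpo.inr_desc]

omit hP in
/-- The pushout of `πA` along the comparison map `τ` of `πP` is a coequaliser of `π₁` and `π₂`. -/
theorem TrivialisedPresentation.exists_isColimit (hf : E f) {A' : Y}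
    {r : D.trivX.obj ⟶ A'} {h : A ⟶ A'} (hpo : IsPushout D.trivX.τ D.πA r h) :
    ∃ hr : D.π₁ ≫ r = D.π₂ ≫ r, Nonempty (IsColimit (Cofork.ofπ r hr)) := by
  have hπP : E D.πP := hE.pullback_snd D.isPullback hf trivial
  have hπA : E D.πA := hE.pullback_fst D.isPullback D.p_mem trivial
  have hfhat : E D.fhat := hE.pullback_fst D.isPullback_fhat hπP trivial
  have := hE.epi (D.trivR.τ_mem hE hΓ hfhat)
  have := hE.epi hπA
  have : Epi r := hpo.epi_inl_of_epi
  have hr : D.π₁ ≫ r = D.π₂ ≫ r := by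
    rw [← cancel_epi D.trivR.τ, ← Category.assoc, D.τ_π₁, ← Category.assoc, D.τ_π₂,
      Category.assoc, Category.assoc, hpo.w, D.isKernelPair_πA.w_assoc]
  -- After `τ`, a map that coequalises `π₁` and `π₂` coequalises the kernel pair of `πA`, so it
  -- factors through `πA` and induces a map on the pushout.
  have hdesc : ∀ s : Cofork D.π₁ D.π₂, ∃ l : A' ⟶ s.pt, r ≫ l = s.π := fun s => by
    obtain ⟨l, hl⟩ := hE.desc hπA D.isKernelPair_πA (D.trivX.τ ≫ s.π) (by
      rw [← Category.assoc, ← D.τ_π₁, ← Category.assoc, ← D.τ_π₂, Category.assoc,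
        Category.assoc, s.condition])
    exact ⟨hpo.desc s.π l hl.symm, hpo.inl_desc _ _ _⟩
  choose l hl using hdesc
  exact ⟨hr, ⟨Cofork.IsColimit.mk _ l hl fun s m hm => (cancel_epi r).1 (hm.trans (hl s).symm)⟩⟩

theorem TrivialisedPresentation.exists_coveringReflection {V W : MorphismProperty Y}
    (hW : IsCornerClass E (fun _ => True) V W) (hV : ∀ A : Y, V (Γ.η A)) (hf : E f) :
    ∃ (A' : Y) (r : D.trivX.obj ⟶ A') (h : A ⟶ A') (g : A' ⟶ B) (hr : D.π₁ ≫ r = D.π₂ ≫ r),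
      Nonempty (IsColimit (Cofork.ofπ r hr)) ∧ D.trivX.τ ≫ r = D.πA ≫ h ∧
      r ≫ g = D.trivX.map ≫ D.p ∧ Γ.IsCoveringReflection f h g ∧ V h := by
  have hπP : E D.πP := hE.pullback_snd D.isPullback hf trivial
  have hπA : E D.πA := hE.pullback_fst D.isPullback D.p_mem trivial
  -- Followed by `toRefl`, which is a pullback of the unit at `P`, the map `τ` becomes the unit at
  -- `X`; hence `V` passes to `τ` by cancellation.
  have hVτ : V D.trivX.τ := by
    refine hW.cancel (g := D.trivX.toRefl) ?_
      (hW.pullback_fst D.trivX.isPullback (Γ.unit_mem _) (hV _))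
    rw [D.trivX.τ_toRefl]
    exact hV _
  obtain ⟨A', r, h, hpo, hh⟩ :=
    hW.exists_pushout (hW.quotient_of_mem hVτ (D.trivX.τ_mem hE hΓ hπP)) hπA
  have hw : D.trivX.τ ≫ D.trivX.map ≫ D.p = D.πA ≫ f := by
    rw [← Category.assoc, D.trivX.τ_map, D.isPullback.w]
  let g := hpo.desc (D.trivX.map ≫ D.p) f hw
  have hrg : r ≫ g = D.trivX.map ≫ D.p := hpo.inl_desc _ _ _
  have hhg : h ≫ g = f := hpo.inr_desc _ _ _
  have hg : E g := hW.quotient_cancel hh (hhg ▸ hf)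
  obtain ⟨hr, hcolim⟩ := D.exists_isColimit hE hΓ hf hpo
  exact ⟨A', r, h, g, hr, hcolim, hpo.w, hrg,
    D.isCoveringReflection hE hP hΓ hf hpo hg (hW.mem_of_quotient hh trivial) hrg hhg,
    hW.of_quotient hh⟩

end

end GaloisStructure

/-! ### Universal arrows and reflectivity -/

section UniversalArrows

variable {Y : Type w} [Category.{w'} Y]

/-- `ρ` is a universal morphism from `A` to the objects satisfying `X`. -/
structure IsUniversalArrow (X : ObjectProperty Y) {A G : Y} (ρ : A ⟶ G) : Prop where
  mem : X G
  existsUnique : ∀ ⦃F : Y⦄, X F → ∀ φ : A ⟶ F, ∃! ψ : G ⟶ F, ρ ≫ ψ = φ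

theorem nonempty_reflective_of_isUniversalArrow (X : ObjectProperty Y)
    (h : ∀ A : Y, ∃ (G : Y) (ρ : A ⟶ G), IsUniversalArrow X ρ) : Nonempty (Reflective X.ι) := by
  choose G ρ hρ using h
  choose ψ hψ hψ' using fun A F hF φ => (hρ A).existsUnique (F := F) hF φ
  let e (A : Y) (F : X.FullSubcategory) :
      ((⟨G A, (hρ A).mem⟩ : X.FullSubcategory) ⟶ F) ≃ (A ⟶ X.ι.obj F) :=
    { toFun := fun x => ρ A ≫ x.hom
      invFun := fun φ => ObjectProperty.homMk (ψ A F.obj F.property φ)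
      left_inv := fun x => X.ι.map_injective (hψ' A F.obj F.property _ x.hom rfl).symm
      right_inv := fun φ => hψ A F.obj F.property φ }
  exact ⟨{ L := Adjunction.leftAdjointOfEquiv (F_obj := fun A => ⟨G A, (hρ A).mem⟩) e
            fun A F F' g x => (Category.assoc _ _ _).symm
           adj := Adjunction.adjunctionOfEquivLeft e
            fun A F F' g x => (Category.assoc _ _ _).symm }⟩

/-- The unit of a reflection agrees with any universal morphism, up to isomorphism. -/
theorem GaloisStructure.exists_isIso_comp_eq_η {E : MorphismProperty Y} (Γ : GaloisStructure E)
    {A G : Y} {ρ : A ⟶ G} (hρ : IsUniversalArrow Γ.X ρ) :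
    ∃ m : G ⟶ Γ.refl A, IsIso m ∧ ρ ≫ m = Γ.η A := by
  obtain ⟨m, hm, -⟩ := hρ.existsUnique (Γ.refl_mem A) (Γ.η A)
  obtain ⟨k, hk⟩ := Γ.exists_desc hρ.mem ρ
  refine ⟨m, ⟨k, (hρ.existsUnique hρ.mem ρ).unique ?_ (Category.comp_id ρ),
    Γ.refl_hom_ext (Γ.refl_mem A) ?_⟩, hm⟩
  · rw [reassoc_of% hm, hk]
  · rw [reassoc_of% hk, hm, Category.comp_id]

end UniversalArrows

/-! ### The categories of the tower -/

section Levels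

variable {C : Type (max u v)} [Category.{v} C] {n : ℕ}

namespace Level

/-- An extension in `Cₙ`, seen as an object of `Cₙ₊₁`. -/
def ofHom {A B : Level.{v, u} C n} (g : A ⟶ B) (hg : levelExt.{v, u} C n g) :
    Level.{v, u} C (n + 1) :=
  ⟨Arrow.mk g.hom, hg⟩

/-- A commutative square in `Cₙ`, seen as a morphism of `Cₙ₊₁`. -/
def homMk {F G : Level.{v, u} C (n + 1)} (t : F.dom ⟶ G.dom) (b : F.cod ⟶ G.cod)
    (w : t ≫ G.toHom = F.toHom ≫ b) : F ⟶ G :=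
  ObjectProperty.homMk (Arrow.homMk (f := F.toArrow) (g := G.toArrow) t.hom b.hom
    (congrArg (isExt.{v, u} C n).ι.map w))

/-- The top side of a morphism of `Cₙ₊₁`. -/
def left {F G : Level.{v, u} C (n + 1)} (φ : F ⟶ G) : F.dom ⟶ G.dom :=
  ObjectProperty.homMk ((show F.toArrow ⟶ G.toArrow from φ.hom).left)

/-- The bottom side of a morphism of `Cₙ₊₁`. -/
def right {F G : Level.{v, u} C (n + 1)} (φ : F ⟶ G) : F.cod ⟶ G.cod :=
  ObjectProperty.homMk ((show F.toArrow ⟶ G.toArrow from φ.hom).right)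

theorem left_toHom {F G : Level.{v, u} C (n + 1)} (φ : F ⟶ G) :
    left φ ≫ G.toHom = F.toHom ≫ right φ :=
  (isExt.{v, u} C n).ι.map_injective (Arrow.w (f := F.toArrow) (g := G.toArrow) φ.hom)

theorem hom_ext {F G : Level.{v, u} C (n + 1)} {φ ψ : F ⟶ G} (hl : left φ = left ψ)
    (hr : right φ = right ψ) : φ = ψ :=
  (isExt.{v, u} C (n + 1)).ι.map_injective (Arrow.hom_ext
    (show F.toArrow ⟶ G.toArrow from φ.hom) (show F.toArrow ⟶ G.toArrow from ψ.hom)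
    (congrArg (isExt.{v, u} C n).ι.map hl)
    (congrArg (isExt.{v, u} C n).ι.map hr))

end Level

/-- A covering reflection, seen as a morphism of `Cₙ₊₁`, is a universal morphism to coverings. -/
theorem GaloisStructure.IsCoveringReflection.isUniversalArrow
    {Γ : GaloisStructure (levelExt.{v, u} C n)} {F : Level.{v, u} C (n + 1)}
    {A' : Level.{v, u} C n} {h : F.dom ⟶ A'} {g : A' ⟶ F.cod}
    (H : Γ.IsCoveringReflection F.toHom h g) :
    IsUniversalArrow (Cov Γ) (Level.homMk (G := Level.ofHom g H.covering.1) h (𝟙 F.cod)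
      (H.fac.trans (Category.comp_id _).symm)) where
  mem := H.covering
  existsUnique G hG φ := by
    obtain ⟨x, ⟨hx₁, hx₂⟩, hx⟩ :=
      H.universal G.toHom hG (Level.left φ) (Level.right φ) (Level.left_toHom φ)
    refine ⟨Level.homMk (F := Level.ofHom g H.covering.1) x (Level.right (F := F) φ) hx₂,
      Level.hom_ext hx₁ (Category.id_comp (Level.right φ)), fun ψ hψ => ?_⟩
    have hr : Level.right ψ = Level.right φ :=
      (Category.id_comp (Level.right ψ)).symm.trans (congrArg Level.right hψ)
    refine Level.hom_ext (hx _ ⟨congrArg Level.left hψ, ?_⟩) hr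
    rw [← hr]
    exact Level.left_toHom ψ

variable [Regular C] [EnoughRegularProjectives C]

variable (C) in
theorem isExtensionClass_levelExt (n : ℕ) :
    IsExtensionClass (levelExt.{v, u} C n) (fun _ => True) :=
  have := hasPullbacks_arr.{v, u} C n
  (isExtensionClass_ext C n).fullSubcategory

variable (C) in
theorem hasExtensionPullbacks_levelExt (n : ℕ) :
    HasExtensionPullbacks (levelExt.{v, u} C n) := fun _ _ _ f g hg => by
  have := hasPullbacks_arr.{v, u} C n
  obtain ⟨P, fst, snd, hP, -⟩ := (isExtensionClass_ext C n).exists_isPullback_fullSubcategory f g hg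
  exact ⟨P, fst, snd, hP⟩

variable (C) in
theorem isCornerClass_level [HasReflexiveCoequalizers C] (n : ℕ) :
    IsCornerClass (levelExt.{v, u} C n) (fun _ => True)
      ((corner.{v, u} C ⊤ n).inverseImage (isExt.{v, u} C n).ι)
      ((corner.{v, u} C (MorphismProperty.regularEpi C) n).inverseImage (isExt.{v, u} C n).ι) :=
  have := hasPullbacks_arr.{v, u} C n
  (isCornerClass_corner C n).fullSubcategory (isExtensionClass_ext C n)

/-- The units of the Galois structures in a tower are invertible away from the initial vertex. -/
theorem GaloisTower.corner_η [HasReflexiveCoequalizers C] (T : GaloisTower.{v, u} C n) :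
    ∀ (k : ℕ) (hk : k ≤ n) (A : Level.{v, u} C k),
      corner.{v, u} C ⊤ k ((T.Γ k hk).η A).hom
  | 0, _, _ => trivial
  | k + 1, hk, A => by
    have hk' : k ≤ n := Nat.le_of_succ_le hk
    have hE := isExtensionClass_levelExt.{v, u} C k
    have hP := hasExtensionPullbacks_levelExt.{v, u} C k
    obtain ⟨D⟩ := GaloisStructure.exists_trivialisedPresentation hE hP
      (T.stronglyBirkhoff k hk') (f := A.toHom) A.property
    -- The construction at level `k`, with the induction hypothesis for its units, yields an `h`
    -- that is invertible away from the initial vertex. Universality identifies `(h, 𝟙)` with the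
    -- unit at level `k + 1`, up to an isomorphism `m`.
    obtain ⟨A', r, h, g, -, -, -, -, H, hh⟩ := D.exists_coveringReflection hE hP
      (T.stronglyBirkhoff k hk') (isCornerClass_level C k) (T.corner_η k hk') A.property
    have hρ := H.isUniversalArrow
    rw [← T.eq_cov k hk] at hρ
    obtain ⟨m, hm, hηm⟩ := (T.Γ (k + 1) hk).exists_isIso_comp_eq_η hρ
    rw [← hηm]
    exact (isCornerClass_level C (k + 1)).comp
      (show cornerMorphisms _ _ from ⟨inferInstanceAs (IsIso (𝟙 A.toArrow.right)), hh⟩)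
      ((isCornerClass_level C (k + 1)).of_isIso m)

end Levels

end HigherCoverings

/-! ### The main theorem -/

theorem mainTheorem6 {C : Type (max u v)} [Category.{v} C] [HigherCoverings.BarrExact C]
    [HasReflexiveCoequalizers C] [HigherCoverings.EnoughRegularProjectives C]
    (n : ℕ) (T : HigherCoverings.GaloisTower.{v, u} C n) :
    Nonempty (Reflective (HigherCoverings.Cov T.last).ι) ∧
    ∀ ⦃A B : HigherCoverings.Level.{v, u} C n⦄ (f : A ⟶ B), HigherCoverings.levelExt.{v, u} C n f →
      Nonempty (T.last.TrivialisedPresentation f) ∧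
      ∀ D : T.last.TrivialisedPresentation f,
        ∃ (A' : HigherCoverings.Level.{v, u} C n) (r : D.trivX.obj ⟶ A') (h : A ⟶ A') (g : A' ⟶ B)
          (hr : D.π₁ ≫ r = D.π₂ ≫ r),
          Nonempty (IsColimit (Cofork.ofπ r hr)) ∧
          D.trivX.τ ≫ r = D.πA ≫ h ∧
          r ≫ g = D.trivX.map ≫ D.p ∧
          T.last.IsCoveringReflection f h g := by
  have hE := HigherCoverings.isExtensionClass_levelExt.{v, u} C n
  have hP := HigherCoverings.hasExtensionPullbacks_levelExt.{v, u} C n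
  have hΓ := T.stronglyBirkhoff n le_rfl
  have hW := HigherCoverings.isCornerClass_level.{v, u} C n
  have hV := T.corner_η n le_rfl
  refine ⟨HigherCoverings.nonempty_reflective_of_isUniversalArrow _ fun F => ?_, fun A B f hf =>
    ⟨HigherCoverings.GaloisStructure.exists_trivialisedPresentation hE hP hΓ hf, fun D => ?_⟩⟩
  · obtain ⟨D⟩ := HigherCoverings.GaloisStructure.exists_trivialisedPresentation hE hP hΓ
      (f := F.toHom) F.property
    obtain ⟨A', r, h, g, -, -, -, -, H, -⟩ :=
      D.exists_coveringReflection hE hP hΓ hW hV F.property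
    exact ⟨_, _, H.isUniversalArrow⟩
  · obtain ⟨A', r, h, g, hr, hc, hτ, hg, H, -⟩ :=
      D.exists_coveringReflection hE hP hΓ hW hV hf
    exact ⟨A', r, h, g, hr, hc, hτ, hg, H⟩
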